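/- For positive integers $n, r, s$ with $r > s$, let $R(n;r,s)$ be the least positive integer $N$ such that, whenever every edge of the complete graph $K_N$ receives a set of exactly $s$ colors from a palette of $r$ colors, there are $n$ vertices such that all the edges between them receive a common color. There are absolute constants $c, c' > 0$ and positive numbers $a_r, b_r$ depending only on $r$ such that, for all integers $n \ge 3$ and $r > s \ge 1$, $$a_r \cdot 2^{c n \max\left(\frac{r-s}{r}, \frac{(r-s)^3}{r^2}\right)} \le R(n;r,s),$$ $$R(n;r,s) \le 2^{c' n \frac{(r-s)^2}{r} \log\left(\frac{r}{\min(s,r-s)}\right)} \quad\text{if } n(r-s)^2 \ge r \text{ (in particular, if } n \ge r\text{)},$$ and, without this restriction, $R(n;r,s) \le b_r \cdot 2^{c' n \frac{(r-s)^2}{r} \log\left(\frac{r}{\min(s,r-s)}\right)}$. Moreover, $R(n;r,s) = 2^{\Theta(nr)}$ when $s/r$ is bounded away from $0$ and $1$: for every $\varepsilon > 0$ there are $c_1, c_2 > 0$ and a function $n_0 : \mathbb{N} \to \mathbb{N}$ such that, for all integers $n \ge 3$ and $r, s \ge 1$ with $\varepsilon r < s < (1-\varepsilon) r$, one has $R(n;r,s)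 \le 2^{c_2 n r}$, and $R(n;r,s) \ge 2^{c_1 n r}$ if $n \ge n_0(r)$. -/

import Mathlib

/-- An `(r, s)`-coloring of the complete graph `K_N` on the vertex set `Fin N`: every edge receives
a set of exactly `s` colors from the palette `Fin r`. -/
abbrev SetColoring (N r s : ℕ) : Type :=
  SimpleGraph.TopEdgeLabeling (Fin N) {A : Finset (Fin r) // A.card = s}

/-- The coloring `χ` has a monochromatic `n`-clique: `n` distinct vertices such that all the edges
between them receive a common color. -/
def SetColoring.HasMonochromaticClique {N r s : ℕ} (χ : SetColoring N r s) (n : ℕ) : Prop :=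
  ∃ S : Finset (Fin N), S.card = n ∧ ∃ i : Fin r,
    ∀ u ∈ S, ∀ v ∈ S, ∀ h : (⊤ : SimpleGraph (Fin N)).Adj u v, i ∈ (χ.get u v h).1

/-- The set-coloring Ramsey number `R(n; r, s)`: the least positive integer `N` such that every
`(r, s)`-coloring of `K_N` has a monochromatic `n`-clique. -/
noncomputable def setColoringRamsey (n r s : ℕ) : ℕ :=
  sInf {N : ℕ | 0 < N ∧ ∀ χ : SetColoring N r s, χ.HasMonochromaticClique n}

/-! Write d = r - s. Each pair of vertices is an edge in s of the r color graphs and a non-edge in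
the other d.

Upper bound: repeatedly passing to the largest color neighborhood of a vertex gives R ≤ (1 +
r/s)^(rn) + 1 (`exists_isNClique_of_pow_le_card`). This has the right order unless d is small
compared with r. If 4d ≤ r, some color has non-edge density O(d/r), and the Erdős–Szemerédi swap
finds a large subset on which the cliques of that color have at most m = O(nd/r) vertices. Doing
this for 2d colors costs a factor of about binom(n, ≤ m)^(2d). Each pair still has at least d of
these 2d colors, so neighborhood chasing among them leaves at most 3^(2dm) vertices
(`card_lt_of_forall_isClique_card_le`). The exponent is of order dm log(r/d), that is, n(d²/r)
log(r/d).

Lower bound: label the edges randomly with ρ labels, so that every n-set sees every label;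
e^(n/(6ρ)) vertices are possible. With ρ about r/d, omitting the color class named by the label
gives the exponent nd/r. For d² ≥ 10r, take about d/4 independent blocks of ρ ≈ 4r/d colors, and let
the vertices be the words of a Reed–Solomon code. Two words agree in few places, so few colors are
lost, and a code of dimension about d²/r raises the exponent to nd³/r²
(`card_le_setColoringRamsey_of_code`). -/

/-! ### Color graphs and reformulations of the Ramsey number -/

/-- The graph formed by the edges whose color set contains `i`. -/
def SetColoring.colorGraph {N r s : ℕ} (χ : SetColoring N r s) (i : Fin r) :
    SimpleGraph (Fin N) where
  Adj u v := ∃ h : (⊤ : SimpleGraph (Fin N)).Adj u v, i ∈ (χ.get u v h).1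
  symm := ⟨fun u v ⟨h, hi⟩ => ⟨h.symm, by rwa [SimpleGraph.EdgeLabeling.get_comm]⟩⟩
  loopless := ⟨fun _ ⟨h, _⟩ => h.ne rfl⟩

theorem SetColoring.hasMonochromaticClique_iff {N r s n : ℕ} (χ : SetColoring N r s) :
    χ.HasMonochromaticClique n ↔ ∃ i S, (χ.colorGraph i).IsNClique n S := by
  constructor
  · rintro ⟨S, hS, i, hi⟩
    exact ⟨i, S, fun u hu v hv huv => ⟨huv, hi u hu v hv huv⟩, hS⟩
  · rintro ⟨i, S, hcl, hS⟩
    refine ⟨S, hS, i, fun u hu v hv h => ?_⟩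
    obtain ⟨_, hi⟩ := hcl hu hv h.ne
    exact hi

open Classical in
theorem SetColoring.card_filter_adj {N r s : ℕ} (χ : SetColoring N r s) {u v : Fin N}
    (h : u ≠ v) : (Finset.univ.filter fun i => (χ.colorGraph i).Adj u v).card = s := by
  have h' : (⊤ : SimpleGraph (Fin N)).Adj u v := h
  refine Eq.trans ?_ (χ.get u v h').2
  congr 1
  ext i
  simp only [Finset.mem_filter, Finset.mem_univ, true_and]
  exact ⟨fun ⟨_, hi⟩ => hi, fun hi => ⟨h', hi⟩⟩

open Classical in
theorem SetColoring.card_filter_not_adj {N r s : ℕ} (χ : SetColoring N r s) {u v : Fin N}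
    (h : u ≠ v) : (Finset.univ.filter fun i => ¬ (χ.colorGraph i).Adj u v).card = r - s := by
  have h1 := χ.card_filter_adj h
  have h2 := Finset.card_filter_add_card_filter_not (s := (Finset.univ : Finset (Fin r)))
    (fun i => (χ.colorGraph i).Adj u v)
  simp only [Finset.card_univ, Fintype.card_fin] at h2
  omega

/-- If R ≥ 2, minimality gives a coloring on R - 1 vertices without a monochromatic clique. The
cases R ≤ 1, including the default value `sInf ∅ = 0`, are trivial, so finiteness of R is not needed
here. -/
theorem setColoringRamsey_le_of_forall {n r s : ℕ} {B : ℝ} (hB : 0 ≤ B)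
    (h : ∀ (N : ℕ) (χ : SetColoring N r s), ¬ χ.HasMonochromaticClique n → (N : ℝ) ≤ B) :
    (setColoringRamsey n r s : ℝ) ≤ B + 1 := by
  rcases Nat.lt_or_ge (setColoringRamsey n r s) 2 with h2 | h2
  · have : (setColoringRamsey n r s : ℝ) ≤ 1 := by exact_mod_cast Nat.lt_succ_iff.mp h2
    linarith
  · have hlt : setColoringRamsey n r s - 1 < setColoringRamsey n r s := by omega
    have hnot := Nat.notMem_of_lt_sInf hlt
    simp only [Set.mem_ofPred_eq, not_and, not_forall] at hnot
    obtain ⟨χ, hχ⟩ := hnot (by omega)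
    have := h _ χ hχ
    rw [Nat.cast_sub (by omega)] at this
    push_cast at this
    linarith

/-- Constructions may live on any vertex type and give an edge more than s colors: the surplus is
discarded, which creates no cliques. `hfin` excludes the default value `sInf ∅ = 0`. -/
theorem card_le_setColoringRamsey {V : Type*} [Fintype V] [DecidableEq V] {n r s : ℕ}
    (U : Sym2 V → Finset (Fin r)) (hU : ∀ e, ¬ e.IsDiag → s ≤ (U e).card)
    (hno : ∀ (i : Fin r) (S : Finset V), S.card = n →
      ∃ u ∈ S, ∃ v ∈ S, u ≠ v ∧ i ∉ U s(u, v))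
    (hfin : ∃ N : ℕ, 0 < N ∧ ∀ χ : SetColoring N r s, χ.HasMonochromaticClique n) :
    Fintype.card V ≤ setColoringRamsey n r s := by
  by_contra! hlt
  obtain ⟨-, hmem⟩ := Nat.sInf_mem hfin
  change ∀ χ : SetColoring (setColoringRamsey n r s) r s, χ.HasMonochromaticClique n at hmem
  have hcard : Fintype.card (Fin (setColoringRamsey n r s)) ≤ Fintype.card V := by
    simpa using hlt.le
  obtain ⟨g⟩ := Function.Embedding.nonempty_of_card_le hcard
  have hdiag : ∀ e ∈ (⊤ : SimpleGraph (Fin (setColoringRamsey n r s))).edgeSet,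
      ¬ (e.map g).IsDiag := by
    intro e
    induction e using Sym2.inductionOn with
    | _ a b => simp
  choose A hAU hA using fun e : (⊤ : SimpleGraph (Fin (setColoringRamsey n r s))).edgeSet =>
    Finset.exists_subset_card_eq (hU _ (hdiag e.1 e.2))
  obtain ⟨S, hS, i, hi⟩ := hmem (fun e => ⟨A e, hA e⟩)
  obtain ⟨u, hu, v, hv, huv, hiU⟩ := hno i (S.map g) (by simpa using hS)
  obtain ⟨u, huS, rfl⟩ := Finset.mem_map.mp hu
  obtain ⟨v, hvS, rfl⟩ := Finset.mem_map.mp hv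
  have hne : (⊤ : SimpleGraph (Fin (setColoringRamsey n r s))).Adj u v :=
    fun h => huv (h ▸ rfl)
  exact hiU (hAU _ (hi u huS v hvS hne))

/-! ### Neighborhood chasing -/

open Classical in
/-- Multicolor Ramsey by neighborhood chasing, for graphs such that every pair is an edge of at
least `σ` of them. -/
theorem exists_isNClique_of_pow_le_card {ι V : Type*} (G : ι → SimpleGraph V) (P : Finset ι)
    (hP : P.Nonempty) {σ : ℕ} (hσ : 0 < σ)
    (hG : ∀ u v, u ≠ v → σ ≤ (P.filter fun i => (G i).Adj u v).card) (T : ℕ) :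
    ∀ (t : ι → ℕ) (W : Finset V), ∑ i ∈ P, t i = T →
      (1 + (P.card : ℝ) / σ) ^ T ≤ W.card →
      ∃ i ∈ P, ∃ S ⊆ W, (G i).IsNClique (t i + 1) S := by
  have hσ' : (0 : ℝ) < σ := by exact_mod_cast hσ
  induction T with
  | zero =>
    intro t W hT hW
    obtain ⟨i, hi⟩ := hP
    have hti : t i = 0 := Finset.sum_eq_zero_iff.mp hT i hi
    have : 0 < W.card := by
      have : (0 : ℝ) < W.card := lt_of_lt_of_le (by positivity) hW
      exact_mod_cast this
    obtain ⟨v, hv⟩ := Finset.card_pos.mp this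
    exact ⟨i, hi, {v}, by simpa using hv, by simp [hti, SimpleGraph.isNClique_iff]⟩
  | succ T ih =>
    intro t W hT hW
    have hWpos : 0 < W.card := by
      have : (0 : ℝ) < W.card := lt_of_lt_of_le (by positivity) hW
      exact_mod_cast this
    obtain ⟨v, hv⟩ := Finset.card_pos.mp hWpos
    by_cases h0 : ∃ i ∈ P, t i = 0
    · obtain ⟨i, hi, hti⟩ := h0
      exact ⟨i, hi, {v}, by simpa using hv, by simp [hti, SimpleGraph.isNClique_iff]⟩
    push Not at h0
    obtain ⟨i, hi, hdeg⟩ : ∃ i ∈ P, (1 + (P.card : ℝ) / σ) ^ T ≤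
        ((W.erase v).filter fun w => (G i).Adj v w).card := by
      -- Double counting: the degrees of v over the colors in P sum to at least σ(|W| - 1). Since
      -- |W| ≥ X(1 + |P|/σ) with X = (1 + |P|/σ)^T ≥ 1, this is at least |P| X, so some degree
      -- reaches X.
      by_contra! hlt
      have h1 : (σ : ℝ) * (W.card - 1) ≤
          ∑ i ∈ P, (((W.erase v).filter fun w => (G i).Adj v w).card : ℝ) := by
        have hdc := Finset.sum_card_bipartiteAbove_eq_sum_card_bipartiteBelow
          (s := P) (t := W.erase v) (fun i w => (G i).Adj v w)
        have h2 : (W.erase v).card * σ ≤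
            ∑ w ∈ W.erase v, (P.filter fun i => (G i).Adj v w).card := by
          rw [← smul_eq_mul, ← Finset.sum_const]
          exact Finset.sum_le_sum fun w hw => hG v w (Finset.ne_of_mem_erase hw).symm
        have h3 : (W.erase v).card * σ ≤
            ∑ i ∈ P, ((W.erase v).filter fun w => (G i).Adj v w).card := h2.trans hdc.symm.le
        have h4 : (((W.erase v).card * σ : ℕ) : ℝ) ≤
            ((∑ i ∈ P, ((W.erase v).filter fun w => (G i).Adj v w).card : ℕ) : ℝ) := by
          exact_mod_cast h3
        rw [Finset.card_erase_of_mem hv] at h4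
        push_cast [Nat.cast_sub (show 1 ≤ W.card from hWpos)] at h4
        linarith
      have h2 := Finset.sum_lt_sum_of_nonempty hP hlt
      rw [Finset.sum_const, nsmul_eq_mul] at h2
      have h3 : (1 : ℝ) ≤ (1 + (P.card : ℝ) / σ) ^ T :=
        one_le_pow₀ (by have : (0 : ℝ) ≤ (P.card : ℝ) / σ := by positivity
                        linarith)
      rw [pow_succ] at hW
      have h4 : (σ : ℝ) * ((1 + (P.card : ℝ) / σ) ^ T * (1 + (P.card : ℝ) / σ)) =
          σ * (1 + (P.card : ℝ) / σ) ^ T + P.card * (1 + (P.card : ℝ) / σ) ^ T := by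
        field_simp
      have h5 := mul_le_mul_of_nonneg_left hW hσ'.le
      nlinarith
    have hsum : ∑ j ∈ P, Function.update t i (t i - 1) j = T := by
      rw [Finset.sum_update_of_mem hi]
      have := Finset.add_sum_erase P t hi
      rw [Finset.sdiff_singleton_eq_erase]
      have := Nat.pos_of_ne_zero (h0 i hi)
      omega
    obtain ⟨j, hj, S, hS, hcl⟩ := ih _ _ hsum hdeg
    have hSW : S ⊆ W := hS.trans ((Finset.filter_subset _ _).trans (Finset.erase_subset _ _))
    by_cases hji : j = i
    · subst hji
      refine ⟨j, hj, insert v S, Finset.insert_subset hv hSW, ?_⟩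
      have := hcl.insert (a := v) fun w hw => (Finset.mem_filter.mp (hS hw)).2
      rw [Function.update_self] at this
      have h1 := Nat.pos_of_ne_zero (h0 j hj)
      rwa [Nat.sub_add_cancel h1] at this
    · rw [Function.update_of_ne hji] at hcl
      exact ⟨j, hj, S, hSW, hcl⟩

/-! ### The Erdős–Szemerédi swap and its iteration over colors -/

/-- Markov's inequality: if `g ≥ M` wherever `p` fails, and the average of `g` is at most `M / 2`,
then `p` holds for at least half of the elements. -/
theorem Finset.card_le_two_mul_card_filter_of_sum_le {α : Type*} (W : Finset α) (g : α → ℝ)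
    (p : α → Prop) [DecidablePred p] {M : ℝ} (hM : 0 < M) (hg : ∀ a ∈ W, 0 ≤ g a)
    (hp : ∀ a ∈ W, ¬ p a → M ≤ g a) (hsum : 2 * ∑ a ∈ W, g a ≤ M * W.card) :
    (W.card : ℝ) ≤ 2 * (W.filter p).card := by
  have h1 : ((W.filter fun a => ¬ p a).card : ℝ) * M ≤ ∑ a ∈ W, g a := by
    rw [← nsmul_eq_mul, ← Finset.sum_const]
    calc ∑ _a ∈ W.filter (fun a => ¬ p a), M ≤ ∑ a ∈ W.filter (fun a => ¬ p a), g a :=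
          Finset.sum_le_sum fun a ha => hp a (Finset.mem_filter.mp ha).1 (Finset.mem_filter.mp ha).2
      _ ≤ ∑ a ∈ W, g a :=
          Finset.sum_le_sum_of_subset_of_nonneg (Finset.filter_subset _ _) fun a ha _ => hg a ha
  have h2 : ((W.filter p).card : ℝ) + (W.filter fun a => ¬ p a).card = W.card := by
    exact_mod_cast Finset.card_filter_add_card_filter_not p
  nlinarith

theorem Finset.card_filter_powerset_card_le {α : Type*} (I : Finset α) {n : ℕ} (hI : I.card ≤ n)
    (m : ℕ) : (I.powerset.filter fun J => J.card ≤ m).card ≤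
      ∑ j ∈ Finset.range (m + 1), n.choose j := by
  classical
  calc (I.powerset.filter fun J => J.card ≤ m).card
      ≤ ((Finset.range (m + 1)).biUnion fun j => I.powersetCard j).card := by
        refine Finset.card_le_card fun J hJ => ?_
        simp only [Finset.mem_filter, Finset.mem_powerset] at hJ
        simp only [Finset.mem_biUnion, Finset.mem_range, Finset.mem_powersetCard]
        exact ⟨J.card, by omega, hJ.1, rfl⟩
    _ ≤ ∑ j ∈ Finset.range (m + 1), (I.powersetCard j).card := Finset.card_biUnion_le
    _ ≤ _ := Finset.sum_le_sum fun j _ => by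
        rw [Finset.card_powersetCard]
        exact Nat.choose_le_choose j hI

theorem Finset.exists_card_le_card_mul_card_fiber {α β : Type*} [DecidableEq β] (W : Finset α)
    (T : Finset β) (hT : T.Nonempty) (f : α → β) (hf : ∀ a ∈ W, f a ∈ T) :
    ∃ b ∈ T, W.card ≤ T.card * (W.filter fun a => f a = b).card := by
  obtain ⟨b, hb, hmax⟩ := T.exists_max_image (fun b => (W.filter fun a => f a = b).card) hT
  refine ⟨b, hb, ?_⟩
  rw [mul_comm]
  exact Finset.card_le_mul_card_image_of_maps_to hf _ hmax

open Classical in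
/-- The swapping argument of Erdős and Szemerédi: a dense graph all of whose cliques have at most
`n` vertices has a large vertex subset in which all cliques have at most `m` vertices. -/
theorem SimpleGraph.exists_subset_forall_isClique_card_le {V : Type*} (G : SimpleGraph V)
    (W : Finset V) {δ : ℝ} (hδ : 0 < δ)
    (hdense : (∑ u ∈ W, ((W.filter fun v => ¬ G.Adj u v).card : ℝ)) ≤ δ * (W.card : ℝ) ^ 2)
    {n m : ℕ} (hn : ∀ K ⊆ W, G.IsClique (K : Set V) → K.card ≤ n) (hm : 8 * δ * n < m + 1) :
    ∃ W' ⊆ W, W.card ≤ 4 * (∑ j ∈ Finset.range (m + 1), n.choose j) * W'.card ∧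
      ∀ K ⊆ W', G.IsClique (K : Set V) → K.card ≤ m := by
  rcases W.eq_empty_or_nonempty with rfl | hne
  · exact ⟨∅, subset_rfl, by simp, fun K hK _ => by simp [Finset.subset_empty.mp hK]⟩
  have hWpos : (0 : ℝ) < W.card := by exact_mod_cast hne.card_pos
  -- Only vertices with at most twice the average allowance of non-neighbors are kept, so that every
  -- vertex of the maximum clique I chosen among them is adjacent to most of W.
  set W₀ := W.filter fun u => ((W.filter fun v => ¬ G.Adj u v).card : ℝ) ≤ 2 * δ * W.card with hW₀
  have hW₀card : (W.card : ℝ) ≤ 2 * W₀.card := by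
    refine W.card_le_two_mul_card_filter_of_sum_le
      (fun u => ((W.filter fun v => ¬ G.Adj u v).card : ℝ)) _ (M := 2 * δ * W.card)
      (by positivity) (fun _ _ => by positivity) (fun u _ hu => (not_le.mp hu).le) ?_
    nlinarith
  have hW₀W : W₀ ⊆ W := Finset.filter_subset _ _
  obtain ⟨I, hI, hImax⟩ := (W₀.powerset.filter fun K : Finset V => G.IsClique (K : Set V)).exists_max_image
    Finset.card ⟨∅, by simp⟩
  simp only [Finset.mem_filter, Finset.mem_powerset, and_imp] at hI hImax
  obtain ⟨hIW₀, hIcl⟩ := hI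
  have hIn : I.card ≤ n := hn I (hIW₀.trans hW₀W) hIcl
  set J : V → Finset V := fun v => I.filter fun u => ¬ G.Adj u v with hJ
  have hJsum : ∑ v ∈ W₀, ((J v).card : ℝ) ≤ n * (2 * δ * W.card) := by
    have hdc := Finset.sum_card_bipartiteAbove_eq_sum_card_bipartiteBelow
      (s := I) (t := W₀) (fun u v => ¬ G.Adj u v)
    calc ∑ v ∈ W₀, ((J v).card : ℝ)
        = ∑ u ∈ I, ((W₀.filter fun v => ¬ G.Adj u v).card : ℝ) := by exact_mod_cast hdc.symm
      _ ≤ ∑ u ∈ I, 2 * δ * W.card := by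
          refine Finset.sum_le_sum fun u hu => le_trans ?_ (Finset.mem_filter.mp (hIW₀ hu)).2
          exact_mod_cast Finset.card_le_card (Finset.filter_subset_filter _ hW₀W)
      _ = I.card * (2 * δ * W.card) := by rw [Finset.sum_const, nsmul_eq_mul]
      _ ≤ n * (2 * δ * W.card) := by
          have : (I.card : ℝ) ≤ n := by exact_mod_cast hIn
          gcongr
  set W₁ := W₀.filter fun v => (J v).card ≤ m with hW₁
  -- The average of |J v| over W₀ is at most 4δn, and 8δn < m + 1, so Markov applies.
  have hW₁card : (W₀.card : ℝ) ≤ 2 * W₁.card := by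
    refine W₀.card_le_two_mul_card_filter_of_sum_le (fun v => ((J v).card : ℝ)) _
      (M := m + 1) (by positivity) (fun _ _ => by positivity) (fun v _ hv => ?_) ?_
    · exact_mod_cast not_le.mp hv
    · have h1 : (n : ℝ) * (2 * δ * W.card) ≤ n * (2 * δ * (2 * W₀.card)) := by gcongr
      have h2 : 8 * δ * n * (W₀.card : ℝ) ≤ (m + 1) * W₀.card := by gcongr
      nlinarith
  obtain ⟨J₀, hJ₀, hfib⟩ := W₁.exists_card_le_card_mul_card_fiber
    (I.powerset.filter fun J => J.card ≤ m) ⟨∅, by simp⟩ J fun v hv => by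
      simp only [Finset.mem_filter, Finset.mem_powerset]
      exact ⟨Finset.filter_subset _ _, (Finset.mem_filter.mp hv).2⟩
  simp only [Finset.mem_filter, Finset.mem_powerset] at hJ₀
  refine ⟨W₁.filter fun v => J v = J₀, ?_, ?_, fun K hK hKcl => ?_⟩
  · exact (Finset.filter_subset _ _).trans ((Finset.filter_subset _ _).trans hW₀W)
  · have h1 : W.card ≤ 4 * W₁.card := by
      have : (W.card : ℝ) ≤ 4 * W₁.card := by linarith
      exact_mod_cast this
    calc W.card ≤ 4 * W₁.card := h1
      _ ≤ 4 * ((∑ j ∈ Finset.range (m + 1), n.choose j) *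
          (W₁.filter fun v => J v = J₀).card) := by
        gcongr
        exact hfib.trans (Nat.mul_le_mul_right _ (I.card_filter_powerset_card_le hIn m))
      _ = _ := by ring
  -- The swap: all of K is joined to I \ J₀, so replacing J₀ by K in I gives a clique inside W₀.
  -- Maximality of I forces |K| ≤ |J₀| ≤ m.
  · have hKJ : ∀ v ∈ K, J v = J₀ := fun v hv => (Finset.mem_filter.mp (hK hv)).2
    have hadj : ∀ u ∈ I \ J₀, ∀ v ∈ K, G.Adj u v := by
      intro u hu v hv
      rw [Finset.mem_sdiff, ← hKJ v hv] at hu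
      by_contra hnot
      exact hu.2 (Finset.mem_filter.mpr ⟨hu.1, hnot⟩)
    have hdisj : Disjoint (I \ J₀) K :=
      Finset.disjoint_left.mpr fun u hu hu' => (hadj u hu u hu').ne rfl
    have hcl : G.IsClique ((I \ J₀ ∪ K : Finset V) : Set V) := by
      intro u hu v hv huv
      simp only [Finset.coe_union, Set.mem_union, Finset.mem_coe] at hu hv
      rcases hu with hu | hu <;> rcases hv with hv | hv
      · exact hIcl (Finset.sdiff_subset hu) (Finset.sdiff_subset hv) huv
      · exact hadj u hu v hv
      · exact (hadj v hv u hu).symm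
      · exact hKcl hu hv huv
    have hsub : I \ J₀ ∪ K ⊆ W₀ := Finset.union_subset (Finset.sdiff_subset.trans hIW₀)
      (hK.trans ((Finset.filter_subset _ _).trans (Finset.filter_subset _ _)))
    have hle := hImax _ hsub hcl
    rw [Finset.card_union_of_disjoint hdisj, Finset.card_sdiff_of_subset hJ₀.1] at hle
    have := Finset.card_le_card hJ₀.1
    omega

open Classical in
/-- Some color of the palette `P` has few non-adjacent pairs. -/
theorem exists_sum_card_not_adj_le {ι V : Type*} (G : ι → SimpleGraph V) (P : Finset ι)
    (hP : P.Nonempty) {d : ℕ}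
    (hG : ∀ u v, u ≠ v → (P.filter fun i => ¬ (G i).Adj u v).card ≤ d) (W : Finset V) :
    ∃ i ∈ P, P.card * ∑ u ∈ W, (W.filter fun v => ¬ (G i).Adj u v).card ≤
      d * W.card ^ 2 + P.card * W.card := by
  have key : ∑ i ∈ P, ∑ u ∈ W, (W.filter fun v => ¬ (G i).Adj u v).card ≤
      d * W.card ^ 2 + P.card * W.card := by
    rw [Finset.sum_comm]
    calc ∑ u ∈ W, ∑ i ∈ P, (W.filter fun v => ¬ (G i).Adj u v).card
        = ∑ u ∈ W, ∑ v ∈ W, (P.filter fun i => ¬ (G i).Adj u v).card :=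
          Finset.sum_congr rfl fun u _ =>
            Finset.sum_card_bipartiteAbove_eq_sum_card_bipartiteBelow
              (s := P) (t := W) (fun i v => ¬ (G i).Adj u v)
      -- On the diagonal every color counts as non-adjacent.
      _ ≤ ∑ u ∈ W, ∑ v ∈ W, (d + if u = v then P.card else 0) := by
          refine Finset.sum_le_sum fun u _ => Finset.sum_le_sum fun v _ => ?_
          split_ifs with h
          · exact (Finset.card_filter_le _ _).trans (Nat.le_add_left _ _)
          · exact hG u v h
      _ = ∑ u ∈ W, (W.card * d + P.card) := by
          refine Finset.sum_congr rfl fun u hu => ?_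
          rw [Finset.sum_add_distrib, Finset.sum_const, smul_eq_mul, Finset.sum_ite_eq, if_pos hu]
      _ = _ := by rw [Finset.sum_const, smul_eq_mul]; ring
  obtain ⟨i, hi, hmin⟩ := P.exists_min_image
    (fun i => ∑ u ∈ W, (W.filter fun v => ¬ (G i).Adj u v).card) hP
  refine ⟨i, hi, le_trans ?_ key⟩
  rw [← smul_eq_mul]
  exact Finset.card_nsmul_le_sum _ _ _ hmin

open Classical in
-- The sparsest complement has density at most d/|P| + 1/|W| ≤ 2d/r + d/r; `hW` absorbs the diagonal
-- term. The swap is applied with δ = 3d/r, whence the 24 in `hm`.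
theorem exists_color_subset_forall_isClique_card_le {ι V : Type*} (G : ι → SimpleGraph V)
    (P : Finset ι) {d r : ℕ} (hd : 0 < d) (hr : 0 < r) (hP : r ≤ 2 * P.card)
    (hG : ∀ u v, u ≠ v → (P.filter fun i => ¬ (G i).Adj u v).card ≤ d) {n m : ℕ}
    (hn : ∀ i, ∀ K : Finset V, (G i).IsClique (K : Set V) → K.card ≤ n)
    (hm : 24 * d * n < r * (m + 1)) (W : Finset V) (hW : r ≤ W.card * d) :
    ∃ i ∈ P, ∃ W' ⊆ W, W.card ≤ 4 * (∑ j ∈ Finset.range (m + 1), n.choose j) * W'.card ∧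
      ∀ K ⊆ W', (G i).IsClique (K : Set V) → K.card ≤ m := by
  have hPpos : 0 < P.card := by omega
  obtain ⟨i, hi, hsum⟩ := exists_sum_card_not_adj_le G P (Finset.card_pos.mp hPpos) hG W
  have hr' : (0 : ℝ) < r := by exact_mod_cast hr
  have hd' : (0 : ℝ) < d := by exact_mod_cast hd
  have hP' : (0 : ℝ) < P.card := by exact_mod_cast hPpos
  have hdense : (∑ u ∈ W, ((W.filter fun v => ¬ (G i).Adj u v).card : ℝ)) ≤
      3 * d / r * (W.card : ℝ) ^ 2 := by
    have h1 : (P.card : ℝ) * ∑ u ∈ W, ((W.filter fun v => ¬ (G i).Adj u v).card : ℝ) ≤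
        d * (W.card : ℝ) ^ 2 + P.card * W.card := by exact_mod_cast hsum
    have h2 : (r : ℝ) ≤ W.card * d := by exact_mod_cast hW
    have h3 : (r : ℝ) ≤ 2 * P.card := by exact_mod_cast hP
    set S := ∑ u ∈ W, ((W.filter fun v => ¬ (G i).Adj u v).card : ℝ)
    have h4 : (r : ℝ) * (d * (W.card : ℝ) ^ 2) ≤ 2 * P.card * (d * (W.card : ℝ) ^ 2) := by gcongr
    have h5 : (P.card : ℝ) * W.card * r ≤ P.card * W.card * (W.card * d) := by gcongr
    have h6 : (P.card : ℝ) * (S * r) ≤ P.card * (3 * d * (W.card : ℝ) ^ 2) := by nlinarith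
    have h7 := le_of_mul_le_mul_left h6 hP'
    rw [div_mul_eq_mul_div, le_div_iff₀ hr']
    exact h7
  have hmδ : 8 * (3 * d / r : ℝ) * n < m + 1 := by
    rw [mul_div_assoc', div_mul_eq_mul_div, div_lt_iff₀ hr']
    have : (24 * d * n : ℝ) < r * (m + 1) := by exact_mod_cast hm
    linarith
  exact ⟨i, hi, (G i).exists_subset_forall_isClique_card_le W (by positivity) hdense
    (fun K _ => hn i K) hmδ⟩

open Classical in
-- Iterates the one-color step over fresh colors. As fewer than 2d ≤ r/2 colors have been used, at
-- least half of the palette remains. The final size Y is kept at least r so that each intermediate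
-- set is large enough for the step.
theorem exists_colors_subset_forall_isClique_card_le {ι V : Type*} [Fintype ι]
    (G : ι → SimpleGraph V) {d : ℕ} (hd : 0 < d) (hd4 : 4 * d ≤ Fintype.card ι)
    (hG : ∀ u v, u ≠ v → (Finset.univ.filter fun i => ¬ (G i).Adj u v).card ≤ d) {n m : ℕ}
    (hn : ∀ i, ∀ K : Finset V, (G i).IsClique (K : Set V) → K.card ≤ n)
    (hm : 24 * d * n < Fintype.card ι * (m + 1)) (j : ℕ) (hj : j ≤ 2 * d) :
    ∀ (Y : ℕ) (W : Finset V), Fintype.card ι ≤ Y →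
      (4 * ∑ j ∈ Finset.range (m + 1), n.choose j) ^ j * Y ≤ W.card →
      ∃ Q : Finset ι, Q.card = j ∧ ∃ W' ⊆ W, Y ≤ W'.card ∧
        ∀ i ∈ Q, ∀ K ⊆ W', (G i).IsClique (K : Set V) → K.card ≤ m := by
  set A := ∑ j ∈ Finset.range (m + 1), n.choose j with hA
  have hApos : 0 < A := by
    refine lt_of_lt_of_le ?_ (Finset.single_le_sum (f := fun j => n.choose j)
      (fun _ _ => Nat.zero_le _) (Finset.mem_range.mpr (Nat.succ_pos m)))
    simp
  induction j with
  | zero => exact fun Y W _ hW => ⟨∅, rfl, W, subset_rfl, by simpa using hW, by simp⟩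
  | succ j ih =>
    intro Y W hY hW
    obtain ⟨Q, hQ, W', hW'W, hW', hK⟩ := ih (by omega) (4 * A * Y) W
      (hY.trans (Nat.le_mul_of_pos_left _ (by omega))) (by rwa [pow_succ, mul_assoc] at hW)
    have hQc : (Finset.univ \ Q).card = Fintype.card ι - j := by
      rw [Finset.card_sdiff_of_subset (Finset.subset_univ _), Finset.card_univ, hQ]
    obtain ⟨i, hi, W'', hW'', hcard, hK'⟩ := exists_color_subset_forall_isClique_card_le G
      (Finset.univ \ Q) hd (r := Fintype.card ι) (by omega) (by omega)
      (fun u v huv => (Finset.card_le_card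
        (Finset.filter_subset_filter _ (Finset.subset_univ _))).trans (hG u v huv))
      hn hm W' (by
        have : Y ≤ 4 * A * Y := Nat.le_mul_of_pos_left _ (by omega)
        exact (hY.trans (this.trans hW')).trans (Nat.le_mul_of_pos_right _ hd))
    have hiQ : i ∉ Q := (Finset.mem_sdiff.mp hi).2
    refine ⟨insert i Q, by rw [Finset.card_insert_of_notMem hiQ, hQ], W'', hW''.trans hW'W,
      Nat.le_of_mul_le_mul_left (hW'.trans hcard) (by omega), ?_⟩
    intro k hk K hKW
    rcases Finset.mem_insert.mp hk with rfl | hk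
    · exact hK' K hKW
    · exact hK k hk K (hKW.trans hW'')

open Classical in
-- A pair misses at most d of the 2d selected colors, hence has at least d of them. Chasing then has
-- ratio 1 + 2d/d = 3 and would produce a clique of size m + 1 in a selected color.
theorem card_lt_of_forall_isClique_card_le {ι V : Type*} [Fintype ι] [Fintype V]
    (G : ι → SimpleGraph V) {d : ℕ} (hd : 0 < d) (hd4 : 4 * d ≤ Fintype.card ι)
    (hG : ∀ u v, u ≠ v → (Finset.univ.filter fun i => ¬ (G i).Adj u v).card ≤ d) {n m : ℕ}
    (hn : ∀ i, ∀ K : Finset V, (G i).IsClique (K : Set V) → K.card ≤ n)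
    (hm : 24 * d * n < Fintype.card ι * (m + 1)) :
    Fintype.card V < (4 * ∑ j ∈ Finset.range (m + 1), n.choose j) ^ (2 * d) *
      (Fintype.card ι * 3 ^ (2 * d * m)) := by
  by_contra! hle
  obtain ⟨Q, hQ, W, -, hW, hK⟩ := exists_colors_subset_forall_isClique_card_le G hd hd4 hG hn hm
    (2 * d) le_rfl (Fintype.card ι * 3 ^ (2 * d * m)) Finset.univ
    (Nat.le_mul_of_pos_right _ (by positivity)) (by simpa using hle)
  have hadj : ∀ u v, u ≠ v → d ≤ (Q.filter fun i => (G i).Adj u v).card := by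
    intro u v huv
    have h1 := Finset.card_filter_add_card_filter_not (s := Q) (fun i => (G i).Adj u v)
    have h2 := (Finset.card_le_card (Finset.filter_subset_filter
      (fun i => ¬ (G i).Adj u v) (Finset.subset_univ Q))).trans (hG u v huv)
    omega
  obtain ⟨i, hi, S, hS, hcl⟩ := exists_isNClique_of_pow_le_card G Q
    (Finset.card_pos.mp (by omega)) hd hadj (2 * d * m) (fun _ => m) W
    (by rw [Finset.sum_const, hQ, smul_eq_mul]) (by
      have hd' : (d : ℝ) ≠ 0 := by exact_mod_cast hd.ne'
      have h3 : (1 + ((Q.card : ℕ) : ℝ) / d) = 3 := by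
        rw [hQ]; push_cast; field_simp; norm_num
      rw [h3]
      have : 3 ^ (2 * d * m) ≤ W.card := (Nat.le_mul_of_pos_left _ (by omega)).trans hW
      exact_mod_cast this)
  have := hK i hi S hS hcl.isClique
  have := hcl.card_eq
  omega

open Classical in
-- The degenerate case m = 0: the subset found by the one-color step has no nonempty clique, so it
-- is empty.
theorem card_mul_lt_of_forall_isClique_card_le {ι V : Type*} [Fintype ι] [Fintype V]
    (G : ι → SimpleGraph V) {d : ℕ} (hd : 0 < d)
    (hG : ∀ u v, u ≠ v → (Finset.univ.filter fun i => ¬ (G i).Adj u v).card ≤ d) {n : ℕ}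
    (hn : ∀ i, ∀ K : Finset V, (G i).IsClique (K : Set V) → K.card ≤ n)
    (hm : 24 * d * n < Fintype.card ι) : Fintype.card V * d < Fintype.card ι := by
  by_contra! hle
  obtain ⟨i, -, W', -, hcard, hK⟩ := exists_color_subset_forall_isClique_card_le G Finset.univ hd
    (r := Fintype.card ι) (by omega) (by rw [Finset.card_univ]; omega) hG hn (m := 0) (by omega)
    Finset.univ (by simpa using hle)
  have hW' : W' = ∅ := by
    by_contra hne
    obtain ⟨v, hv⟩ := Finset.nonempty_iff_ne_empty.mpr hne
    have := hK {v} (by simpa using hv) (by simp)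
    simp at this
  have hV : Fintype.card V = 0 := by simpa [hW'] using hcard
  rw [hV] at hle
  omega

/-! ### Upper bounds for the Ramsey number -/

theorem SetColoring.card_lt_pow_of_not_hasMonochromaticClique {N n r s : ℕ} (hn : 1 ≤ n)
    (hs : 1 ≤ s) (hsr : s < r) (χ : SetColoring N r s) (hχ : ¬ χ.HasMonochromaticClique n) :
    (N : ℝ) < (1 + (r : ℝ) / s) ^ (r * n) := by
  classical
  by_contra! hle
  refine hχ (χ.hasMonochromaticClique_iff.mpr ?_)
  have h0 : (0 : ℝ) ≤ (r : ℝ) / s := by positivity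
  have : Nonempty (Fin r) := ⟨⟨0, by omega⟩⟩
  obtain ⟨i, -, S, -, hS⟩ := exists_isNClique_of_pow_le_card χ.colorGraph Finset.univ
    Finset.univ_nonempty hs (fun u v huv => (χ.card_filter_adj huv).ge) (r * (n - 1))
    (fun _ => n - 1) Finset.univ (by simp) (by
      rw [Finset.card_univ, Finset.card_univ, Fintype.card_fin, Fintype.card_fin]
      refine le_trans (pow_le_pow_right₀ (by linarith) ?_) hle
      exact Nat.mul_le_mul_left _ (Nat.sub_le _ _))
  exact ⟨i, S, by rwa [Nat.sub_add_cancel hn] at hS⟩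

theorem setColoringRamsey_le_pow {n r s : ℕ} (hn : 1 ≤ n) (hs : 1 ≤ s) (hsr : s < r) :
    (setColoringRamsey n r s : ℝ) ≤ (1 + (r : ℝ) / s) ^ (r * n) + 1 :=
  setColoringRamsey_le_of_forall (by positivity) fun _ χ hχ =>
    (χ.card_lt_pow_of_not_hasMonochromaticClique hn hs hsr hχ).le

theorem exists_forall_hasMonochromaticClique {n r s : ℕ} (hn : 1 ≤ n) (hs : 1 ≤ s) (hsr : s < r) :
    ∃ N : ℕ, 0 < N ∧ ∀ χ : SetColoring N r s, χ.HasMonochromaticClique n := by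
  obtain ⟨N, hN⟩ := exists_nat_gt ((1 + (r : ℝ) / s) ^ (r * n))
  have h0 : (0 : ℝ) < (1 + (r : ℝ) / s) ^ (r * n) := by positivity
  refine ⟨N, by exact_mod_cast h0.trans hN, fun χ => ?_⟩
  by_contra hχ
  exact (hN.trans (χ.card_lt_pow_of_not_hasMonochromaticClique hn hs hsr hχ)).false

theorem SetColoring.card_le_of_isClique {N n r s : ℕ} (χ : SetColoring N r s)
    (hχ : ¬ χ.HasMonochromaticClique n) (i : Fin r) (K : Finset (Fin N))
    (hK : (χ.colorGraph i).IsClique (K : Set (Fin N))) : K.card ≤ n := by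
  by_contra! hlt
  obtain ⟨S, hSK, hS⟩ := Finset.exists_subset_card_eq hlt.le
  exact hχ (χ.hasMonochromaticClique_iff.mpr
    ⟨i, S, hK.subset (by exact_mod_cast hSK), hS⟩)

/-- For x ≤ 1 and j ≤ m one has x^m ≤ x^j, so x^m times the sum is at most (1 + x)^n ≤ e^(nx). -/
theorem sum_range_choose_le_exp (n m : ℕ) {x : ℝ} (hx : 0 < x) (hx1 : x ≤ 1) :
    ((∑ j ∈ Finset.range (m + 1), n.choose j : ℕ) : ℝ) ≤ Real.exp (m * Real.log (1 / x) + n * x) := by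
  have h1 : x ^ m * ((∑ j ∈ Finset.range (m + 1), n.choose j : ℕ) : ℝ) ≤ (x + 1) ^ n := by
    push_cast
    rw [Finset.mul_sum, add_pow]
    calc ∑ j ∈ Finset.range (m + 1), x ^ m * (n.choose j : ℝ)
        ≤ ∑ j ∈ Finset.range (m + 1), x ^ j * (n.choose j : ℝ) := by
          refine Finset.sum_le_sum fun j hj => ?_
          have : x ^ m ≤ x ^ j :=
            pow_le_pow_of_le_one hx.le hx1 (Nat.lt_succ_iff.mp (Finset.mem_range.mp hj))
          gcongr
      _ ≤ ∑ j ∈ Finset.range (max m n + 1), x ^ j * (n.choose j : ℝ) := by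
          refine Finset.sum_le_sum_of_subset_of_nonneg ?_ fun _ _ _ => by positivity
          exact Finset.range_subset_range.mpr (by omega)
      _ = ∑ j ∈ Finset.range (n + 1), x ^ j * (n.choose j : ℝ) := by
          symm
          refine Finset.sum_subset (Finset.range_subset_range.mpr (by omega)) fun j _ hj => ?_
          rw [Nat.choose_eq_zero_of_lt (by simpa using hj)]
          simp
      _ = _ := by simp
  have h2 : (x + 1) ^ n ≤ Real.exp (n * x) := by
    rw [Real.exp_nat_mul]
    exact pow_le_pow_left₀ (by positivity) (Real.add_one_le_exp x) n
  have h3 : Real.exp (m * Real.log (1 / x)) = (x ^ m)⁻¹ := by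
    rw [Real.exp_nat_mul, Real.exp_log (by positivity), one_div, inv_pow]
  rw [Real.exp_add, h3, ← div_eq_inv_mul, le_div_iff₀ (by positivity)]
  linarith

/-- If 24dn < r, the case m = 0 bounds R by r/d + 1. Otherwise m = ⌊24dn/r⌋, and the binomial sum is
estimated with x = d/r. The hypothesis nd² ≥ r makes the target exponent at least log(r/d), which
absorbs the lower-order factors. -/
theorem setColoringRamsey_le_exp_of_four_mul_le {n r s : ℕ} (hn : 1 ≤ n)
    (hsr : s < r) (h4 : 4 * (r - s) ≤ r) (hnr : r ≤ n * (r - s) ^ 2) :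
    (setColoringRamsey n r s : ℝ) ≤ Real.exp (400 * (n * ((r - s : ℕ) : ℝ) ^ 2 / r *
      Real.log ((r : ℝ) / (r - s : ℕ)))) := by
  obtain ⟨d, hd⟩ : ∃ d, d = r - s := ⟨_, rfl⟩
  rw [← hd] at h4 hnr ⊢
  have hdpos : 0 < d := by omega
  have hd1 : (1 : ℝ) ≤ d := by exact_mod_cast hdpos
  have hd' : (0 : ℝ) < d := by linarith
  have hr' : (0 : ℝ) < r := by exact_mod_cast (by omega : 0 < r)
  have hn' : (0 : ℝ) < n := by exact_mod_cast (by omega : 0 < n)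
  have hrd : (4 : ℝ) ≤ r / d := by rw [le_div_iff₀ hd']; exact_mod_cast h4
  set L := Real.log ((r : ℝ) / d) with hL
  have hL1 : 1 ≤ L := by
    rw [hL, Real.le_log_iff_exp_le (by positivity)]
    linarith [Real.exp_one_lt_d9]
  have hexpL : Real.exp L = r / d := Real.exp_log (by positivity)
  have hx1 : 1 ≤ (n : ℝ) * d ^ 2 / r := by
    rw [le_div_iff₀ hr', one_mul]; exact_mod_cast hnr
  set x := (n : ℝ) * (d : ℝ) ^ 2 / r * L with hx
  have hxL : L ≤ x := by rw [hx]; nlinarith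
  by_cases hreg : 24 * d * n < r
  · have h1 : (setColoringRamsey n r s : ℝ) ≤ r / d + 1 := by
      refine setColoringRamsey_le_of_forall (by positivity) fun N χ hχ => ?_
      have := card_mul_lt_of_forall_isClique_card_le χ.colorGraph hdpos
        (fun u v huv => by rw [χ.card_filter_not_adj huv, hd]) (χ.card_le_of_isClique hχ)
        (by simpa using hreg)
      simp only [Fintype.card_fin] at this
      rw [le_div_iff₀ hd']
      exact_mod_cast this.le
    calc (setColoringRamsey n r s : ℝ) ≤ r / d + 1 := h1
      _ ≤ (r / d) * (r / d) := by nlinarith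
      _ = Real.exp (L + L) := by rw [Real.exp_add, hexpL]
      _ ≤ _ := Real.exp_le_exp.mpr (by linarith)
  · set m := 24 * d * n / r with hm
    have hmle : (m : ℝ) ≤ 24 * (d * n / r) := by
      have : m * r ≤ 24 * d * n := Nat.div_mul_le_self _ _
      rw [mul_div_assoc', le_div_iff₀ hr']
      have h2 : (m : ℝ) * r ≤ 24 * d * n := by exact_mod_cast this
      linarith
    set y := (d : ℝ) * n / r with hy
    have hy1 : 1 ≤ 24 * y := by
      rw [hy, mul_div_assoc', le_div_iff₀ hr', one_mul]
      have : (r : ℝ) ≤ 24 * d * n := by exact_mod_cast not_lt.mp hreg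
      linarith
    have hxy : x = d * (y * L) := by rw [hx, hy]; ring
    have hyL : y ≤ y * L := by nlinarith
    have h1 : (setColoringRamsey n r s : ℝ) ≤ Real.exp (290 * x) + 1 := by
      refine setColoringRamsey_le_of_forall (by positivity) fun N χ hχ => ?_
      have hlt := card_lt_of_forall_isClique_card_le χ.colorGraph hdpos (by simpa using h4)
        (fun u v huv => by rw [χ.card_filter_not_adj huv, hd]) (χ.card_le_of_isClique hχ)
        (m := m) (by
          rw [Fintype.card_fin, hm]
          exact Nat.lt_mul_div_succ _ (by omega))
      simp only [Fintype.card_fin] at hlt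
      have hA := sum_range_choose_le_exp n m (x := (d : ℝ) / r) (by positivity) (by
        rw [div_le_one hr']; exact_mod_cast (by omega : d ≤ r))
      rw [one_div_div, ← hL] at hA
      have hexp2 : (4 : ℝ) ≤ Real.exp 2 := by
        have := Real.exp_one_gt_d9
        rw [show (2 : ℝ) = 1 + 1 by norm_num, Real.exp_add]
        nlinarith
      have hlt' : (N : ℝ) ≤ (4 * ((∑ j ∈ Finset.range (m + 1), n.choose j : ℕ) : ℝ)) ^ (2 * d) *
          (r * 3 ^ (2 * d * m)) := by exact_mod_cast hlt.le
      -- The stray factor r is split as (r/d) · d, both parts of which fit into the target exponent.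
      have hr_exp : (r : ℝ) ≤ Real.exp (L + d) := by
        rw [Real.exp_add, hexpL]
        calc (r : ℝ) = r / d * d := by field_simp
          _ ≤ r / d * Real.exp d := by
            gcongr
            linarith [Real.add_one_le_exp (d : ℝ)]
      calc (N : ℝ) ≤ _ := hlt'
        _ ≤ (Real.exp 2 * Real.exp (m * L + n * (d / r))) ^ (2 * d) *
            (Real.exp (L + d) * Real.exp 2 ^ (2 * d * m)) := by
          gcongr
          linarith
        _ = Real.exp ((2 * d : ℕ) * (2 + (m * L + n * (d / r))) +
            (L + d + (2 * d * m : ℕ) * 2)) := by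
          rw [← Real.exp_add, ← Real.exp_nat_mul, ← Real.exp_nat_mul, ← Real.exp_add,
            ← Real.exp_add]
        _ ≤ Real.exp (290 * x) := by
          refine Real.exp_le_exp.mpr ?_
          have e1 : (n : ℝ) * (d / r) = y := by rw [hy]; ring
          rw [e1]
          push_cast
          have e2 : (m : ℝ) * L ≤ 24 * (y * L) := by nlinarith
          have e3 : (d : ℝ) * (2 + (m * L + y)) ≤ d * (73 * (y * L)) := by
            refine mul_le_mul_of_nonneg_left ?_ hd'.le
            linarith
          have e4 : (d : ℝ) * m ≤ d * (24 * (y * L)) := by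
            refine mul_le_mul_of_nonneg_left ?_ hd'.le
            linarith
          have e5 : (d : ℝ) * 1 ≤ d * (24 * (y * L)) := by
            refine mul_le_mul_of_nonneg_left ?_ hd'.le
            linarith
          linarith
    have hx24 : 1 ≤ 24 * x := by linarith
    calc (setColoringRamsey n r s : ℝ) ≤ Real.exp (290 * x) + 1 := h1
      _ ≤ Real.exp (290 * x) * Real.exp (24 * x) := by
        have e1 : 1 ≤ Real.exp (290 * x) := Real.one_le_exp (by linarith)
        have e2 := Real.add_one_le_exp (24 * x)
        nlinarith
      _ = Real.exp (290 * x + 24 * x) := (Real.exp_add _ _).symm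
      _ ≤ _ := Real.exp_le_exp.mpr (by linarith)

theorem two_le_div_min {r s : ℕ} (hs : 1 ≤ s) (hsr : s < r) :
    (2 : ℝ) ≤ (r : ℝ) / min (s : ℝ) ((r : ℝ) - s) := by
  have h1 : (1 : ℝ) ≤ s := by exact_mod_cast hs
  have h2 : (s : ℝ) < r := by exact_mod_cast hsr
  have hmin : (0 : ℝ) < min (s : ℝ) ((r : ℝ) - s) := lt_min (by linarith) (by linarith)
  rw [le_div_iff₀ hmin]
  linarith [min_le_left (s : ℝ) ((r : ℝ) - s), min_le_right (s : ℝ) ((r : ℝ) - s)]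

/-- Here r² ≤ 16(r - s)², so the exponent rn of plain chasing already has the required order; 48 = 3
· 16. -/
theorem setColoringRamsey_le_exp_of_lt_four_mul {n r s : ℕ} (hn : 1 ≤ n) (hs : 1 ≤ s)
    (hsr : s < r) (h4 : r < 4 * (r - s)) :
    (setColoringRamsey n r s : ℝ) ≤ Real.exp (48 * (n * ((r : ℝ) - s) ^ 2 / r *
      Real.log ((r : ℝ) / min (s : ℝ) ((r : ℝ) - s)))) := by
  have hs1 : (1 : ℝ) ≤ s := by exact_mod_cast hs
  have hsr' : (s : ℝ) < r := by exact_mod_cast hsr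
  have hr' : (0 : ℝ) < r := by linarith
  have hρ2 := two_le_div_min hs hsr
  have hρs : (r : ℝ) / s ≤ r / min (s : ℝ) ((r : ℝ) - s) :=
    div_le_div_of_nonneg_left hr'.le (lt_min (by linarith) (by linarith)) (min_le_left _ _)
  set ρ := (r : ℝ) / min (s : ℝ) ((r : ℝ) - s)
  have hrn : 1 ≤ r * n := Nat.mul_pos (by omega) (by omega)
  have hlog : 0 ≤ Real.log ρ := Real.log_nonneg (by linarith)
  calc (setColoringRamsey n r s : ℝ) ≤ (1 + (r : ℝ) / s) ^ (r * n) + 1 :=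
        setColoringRamsey_le_pow hn hs hsr
    _ ≤ (ρ ^ 2) ^ (r * n) + (ρ ^ 2) ^ (r * n) := by
        have h1 : 1 + (r : ℝ) / s ≤ ρ ^ 2 := by nlinarith
        have h2 : (1 : ℝ) ≤ (ρ ^ 2) ^ (r * n) := one_le_pow₀ (by nlinarith)
        gcongr
    _ ≤ (ρ ^ 2) ^ (r * n) * ρ ^ (r * n) := by
        have h2 : (2 : ℝ) ≤ ρ ^ (r * n) :=
          hρ2.trans (le_self_pow₀ (by linarith) (by omega))
        have h3 : (0 : ℝ) < (ρ ^ 2) ^ (r * n) := by positivity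
        nlinarith
    _ = Real.exp ((3 * (r * n) : ℕ) * Real.log ρ) := by
        rw [Real.exp_nat_mul, Real.exp_log (by linarith)]
        ring
    _ ≤ _ := by
        refine Real.exp_le_exp.mpr ?_
        rw [← mul_assoc (48 : ℝ)]
        refine mul_le_mul_of_nonneg_right ?_ hlog
        rw [mul_div_assoc', le_div_iff₀ hr']
        have h5 : (r : ℝ) ≤ 4 * (r - s) := by
          rw [← Nat.cast_sub hsr.le]; exact_mod_cast h4.le
        push_cast
        have h6 : (r : ℝ) * r ≤ 16 * (r - s) ^ 2 := by nlinarith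
        have h7 : (n : ℝ) * (r * r) ≤ n * (16 * (r - s) ^ 2) := by gcongr
        linarith

theorem setColoringRamsey_le_exp {n r s : ℕ} (hn : 1 ≤ n) (hs : 1 ≤ s) (hsr : s < r)
    (hnr : (r : ℝ) ≤ n * ((r : ℝ) - s) ^ 2) :
    (setColoringRamsey n r s : ℝ) ≤ Real.exp (400 * (n * ((r : ℝ) - s) ^ 2 / r *
      Real.log ((r : ℝ) / min (s : ℝ) ((r : ℝ) - s)))) := by
  rcases le_or_gt (4 * (r - s)) r with h4 | h4
  · have hcast : ((r - s : ℕ) : ℝ) = (r : ℝ) - s := Nat.cast_sub hsr.le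
    have hmin : min (s : ℝ) ((r : ℝ) - s) = (r : ℝ) - s := by
      refine min_eq_right ?_
      rw [← hcast]
      exact_mod_cast (by omega : r - s ≤ s)
    have := setColoringRamsey_le_exp_of_four_mul_le hn hsr h4 (by
      rw [← hcast] at hnr; exact_mod_cast hnr)
    rw [hmin]
    rwa [hcast] at this
  · refine (setColoringRamsey_le_exp_of_lt_four_mul hn hs hsr h4).trans (Real.exp_le_exp.mpr ?_)
    have hlog := Real.log_nonneg (one_le_two.trans (two_le_div_min hs hsr))
    have : 0 ≤ (n : ℝ) * ((r : ℝ) - s) ^ 2 / r *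
      Real.log ((r : ℝ) / min (s : ℝ) ((r : ℝ) - s)) := by positivity
    linarith

/-! ### Lower bound constructions: random labelings and codes -/

/-- The probabilistic lower bound: an edge labeling for which every `n`-set sees every label. -/
theorem exists_labeling_forall_label_mem {V : Type*} [Fintype V] [DecidableEq V] {n ρ : ℕ}
    (hcount : ((Fintype.card V : ℝ)) ^ n * ρ * (1 - 1 / (ρ : ℝ)) ^ (n.choose 2) < 1) (hρ : 0 < ρ) :
    ∃ f : Sym2 V → Fin ρ, ∀ (j : Fin ρ) (S : Finset V), S.card = n →
      ∃ u ∈ S, ∃ v ∈ S, u ≠ v ∧ f s(u, v) = j := by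
  classical
  set E : Finset V → Finset (Sym2 V) := fun S => S.offDiag.image Sym2.mk.uncurry with hE
  -- The labelings for which the label `q.2` is absent from the pairs inside `q.1`. A union bound by
  -- counting shows that they do not exhaust all labelings.
  set bad : Finset V × Fin ρ → Finset (Sym2 V → Fin ρ) := fun q =>
    Fintype.piFinset fun e => if e ∈ E q.1 then {q.2}ᶜ else Finset.univ with hbad
  set M := Fintype.card (Sym2 V) with hM
  have hρ' : (0 : ℝ) < ρ := by exact_mod_cast hρ
  have hbadcard : ∀ q ∈ Finset.univ.powersetCard n ×ˢ Finset.univ,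
      ((bad q).card : ℝ) = (1 - 1 / (ρ : ℝ)) ^ (n.choose 2) * (ρ : ℝ) ^ M := by
    intro q hq
    have hq1 : q.1.card = n := (Finset.mem_powersetCard.mp (Finset.mem_product.mp hq).1).2
    have hEc : (E q.1).card = n.choose 2 := by rw [hE, ← hq1]; exact Sym2.card_image_offDiag q.1
    have hle : n.choose 2 ≤ M := hEc ▸ Finset.card_le_univ (E q.1)
    have h1 : (bad q).card = (ρ - 1) ^ (n.choose 2) * ρ ^ (M - n.choose 2) := by
      rw [hbad, Fintype.card_piFinset]
      have : ∀ e : Sym2 V, (if e ∈ E q.1 then ({q.2}ᶜ : Finset (Fin ρ)) else Finset.univ).card =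
          if e ∈ E q.1 then ρ - 1 else ρ := by
        intro e
        split_ifs
        · rw [Finset.card_compl, Finset.card_singleton, Fintype.card_fin]
        · rw [Finset.card_univ, Fintype.card_fin]
      simp_rw [this]
      rw [Finset.prod_ite, Finset.prod_const, Finset.prod_const, Finset.filter_mem_eq_inter,
        Finset.univ_inter, hEc, Finset.filter_not, Finset.filter_mem_eq_inter, Finset.univ_inter,
        Finset.card_sdiff_of_subset (Finset.subset_univ _), hEc, Finset.card_univ]
    rw [h1]
    push_cast [Nat.cast_sub (show 1 ≤ ρ from hρ)]
    have h2 : (ρ : ℝ) ^ M = (ρ : ℝ) ^ n.choose 2 * (ρ : ℝ) ^ (M - n.choose 2) := by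
      rw [← pow_add, Nat.add_sub_cancel' hle]
    rw [h2, ← mul_assoc, ← mul_pow]
    congr 2
    field_simp
  have hlt : ((Finset.univ.powersetCard n ×ˢ Finset.univ).biUnion bad).card <
      (Finset.univ : Finset (Sym2 V → Fin ρ)).card := by
    have h1 : (((Finset.univ.powersetCard n ×ˢ Finset.univ).biUnion bad).card : ℝ) ≤
        ∑ q ∈ Finset.univ.powersetCard n ×ˢ Finset.univ, ((bad q).card : ℝ) := by
      exact_mod_cast Finset.card_biUnion_le
    rw [Finset.sum_congr rfl hbadcard, Finset.sum_const, Finset.card_product,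
      Finset.card_powersetCard, Finset.card_univ, Finset.card_univ, Fintype.card_fin,
      nsmul_eq_mul] at h1
    have h2 : (((Fintype.card V).choose n : ℕ) : ℝ) ≤ (Fintype.card V : ℝ) ^ n := by
      exact_mod_cast Nat.choose_le_pow _ _
    have h0 : (0 : ℝ) ≤ 1 - 1 / (ρ : ℝ) := by
      have : 1 / (ρ : ℝ) ≤ 1 := by
        rw [div_le_one hρ']; exact_mod_cast hρ
      linarith
    have h3 : (((Finset.univ.powersetCard n ×ˢ Finset.univ).biUnion bad).card : ℝ) <
        (ρ : ℝ) ^ M := by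
      refine h1.trans_lt ?_
      push_cast
      calc (((Fintype.card V).choose n : ℕ) : ℝ) * ρ *
            ((1 - 1 / (ρ : ℝ)) ^ (n.choose 2) * (ρ : ℝ) ^ M)
          ≤ (Fintype.card V : ℝ) ^ n * ρ *
            ((1 - 1 / (ρ : ℝ)) ^ (n.choose 2) * (ρ : ℝ) ^ M) := by gcongr
        _ = (Fintype.card V : ℝ) ^ n * ρ * (1 - 1 / (ρ : ℝ)) ^ (n.choose 2) * (ρ : ℝ) ^ M := by
          ring
        _ < 1 * (ρ : ℝ) ^ M := by gcongr
        _ = _ := one_mul _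
    rw [Finset.card_univ, Fintype.card_fun, Fintype.card_fin]
    exact_mod_cast h3
  obtain ⟨f, -, hf⟩ := Finset.exists_mem_notMem_of_card_lt_card hlt
  refine ⟨f, fun j S hS => ?_⟩
  by_contra! hno
  refine hf (Finset.mem_biUnion.mpr ⟨(S, j), ?_, ?_⟩)
  · simp [hS]
  · rw [hbad, Fintype.mem_piFinset]
    intro e
    split_ifs with he
    · obtain ⟨⟨u, v⟩, huv, rfl⟩ := Finset.mem_image.mp he
      rw [Finset.mem_offDiag] at huv
      simpa using hno u huv.1 v huv.2.1 huv.2.2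
    · exact Finset.mem_univ _

theorem exists_labeling_of_card_le_exp {V : Type*} [Fintype V] [DecidableEq V] {n ρ : ℕ}
    (hρ : 0 < ρ) (hn : 3 ≤ n) (hnρ : 3 * ρ ≤ n)
    (hV : (Fintype.card V : ℝ) ≤ Real.exp (n / (6 * ρ))) :
    ∃ f : Sym2 V → Fin ρ, ∀ (j : Fin ρ) (S : Finset V), S.card = n →
      ∃ u ∈ S, ∃ v ∈ S, u ≠ v ∧ f s(u, v) = j := by
  refine exists_labeling_forall_label_mem ?_ hρ
  have hρ' : (1 : ℝ) ≤ ρ := by exact_mod_cast hρ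
  have hn' : (3 : ℝ) ≤ n := by exact_mod_cast hn
  have hnρ' : (3 : ℝ) * ρ ≤ n := by exact_mod_cast hnρ
  have h1 : (Fintype.card V : ℝ) ^ n ≤ Real.exp (n * (n / (6 * ρ))) := by
    rw [Real.exp_nat_mul]
    exact pow_le_pow_left₀ (by positivity) hV n
  have h2 : (ρ : ℝ) ≤ Real.exp (ρ - 1) := by linarith [Real.add_one_le_exp ((ρ : ℝ) - 1)]
  have hρ1 : 0 ≤ 1 - 1 / (ρ : ℝ) := by
    rw [sub_nonneg, div_le_one (by linarith)]
    exact hρ'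
  have h3 : (1 - 1 / (ρ : ℝ)) ^ (n.choose 2) ≤ Real.exp ((n.choose 2 : ℕ) * (-(1 / (ρ : ℝ)))) := by
    rw [Real.exp_nat_mul]
    exact pow_le_pow_left₀ hρ1 (Real.one_sub_le_exp_neg _) _
  have h0 : 0 ≤ (1 - 1 / (ρ : ℝ)) ^ (n.choose 2) := pow_nonneg hρ1 _
  calc (Fintype.card V : ℝ) ^ n * ρ * (1 - 1 / (ρ : ℝ)) ^ (n.choose 2)
      ≤ Real.exp (n * (n / (6 * ρ))) * Real.exp (ρ - 1) *
        Real.exp ((n.choose 2 : ℕ) * (-(1 / (ρ : ℝ)))) := by gcongr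
    _ = Real.exp (n * (n / (6 * ρ)) + (ρ - 1) + (n.choose 2 : ℕ) * (-(1 / (ρ : ℝ)))) := by
      rw [Real.exp_add, Real.exp_add]
    _ < Real.exp 0 := by
      refine Real.exp_lt_exp.mpr ?_
      rw [Nat.cast_choose_two]
      have e1 : (n : ℝ) * (n / (6 * ρ)) + (ρ - 1) + n * ((n : ℝ) - 1) / 2 * (-(1 / (ρ : ℝ))) =
          (n * n / 6 - n * (n - 1) / 2 + ρ * (ρ - 1)) / ρ := by
        field_simp
        ring
      rw [e1]
      -- For n ≥ 3, n(n - 1)/2 ≥ n²/3, which leaves -n²/6 + ρ(ρ - 1), and ρ ≤ n/3.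
      refine div_neg_of_neg_of_pos ?_ (by linarith)
      nlinarith
    _ = 1 := Real.exp_zero

/-- Splitting the palette into `ρ` classes of at most `r - s` colors and omitting one class on each
edge. -/
theorem card_le_setColoringRamsey_of_labeling {V : Type*} [Fintype V] [DecidableEq V]
    {n r s ρ : ℕ} (hn : 1 ≤ n) (hs : 1 ≤ s) (hsr : s < r) (hρ : r ≤ (r - s) * ρ)
    (f : Sym2 V → Fin ρ)
    (hf : ∀ (j : Fin ρ) (S : Finset V), S.card = n →
      ∃ u ∈ S, ∃ v ∈ S, u ≠ v ∧ f s(u, v) = j) :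
    Fintype.card V ≤ setColoringRamsey n r s := by
  refine card_le_setColoringRamsey
    -- The color classes are intervals of length r - s, indexed by the quotient.
    (fun e => Finset.univ.filter fun i : Fin r => i.1 / (r - s) ≠ (f e).1) (fun e _ => ?_)
    (fun i S hS => ?_) (exists_forall_hasMonochromaticClique hn hs hsr)
  · have h1 := Finset.card_filter_add_card_filter_not (s := (Finset.univ : Finset (Fin r)))
      (fun i => i.1 / (r - s) ≠ (f e).1)
    have h2 : (Finset.univ.filter fun i : Fin r => ¬ i.1 / (r - s) ≠ (f e).1).card ≤ r - s := by
      calc (Finset.univ.filter fun i : Fin r => ¬ i.1 / (r - s) ≠ (f e).1).card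
          ≤ (Finset.range (r - s)).card := by
            refine Finset.card_le_card_of_injOn (fun i => i.1 % (r - s)) ?_ ?_
            · intro i _
              simpa using Nat.mod_lt _ (by omega)
            · intro i hi j hj hij
              simp only [Finset.coe_filter, Set.mem_ofPred_eq, Finset.mem_univ, true_and,
                not_not] at hi hj
              have hi' := Nat.div_add_mod i.1 (r - s)
              have hj' := Nat.div_add_mod j.1 (r - s)
              simp only at hij
              rw [hi, hij] at hi'
              rw [hj] at hj'
              exact Fin.ext (hi'.symm.trans hj')
        _ = r - s := Finset.card_range _
    rw [Finset.card_univ, Fintype.card_fin] at h1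
    omega
  · have hi : i.1 / (r - s) < ρ := Nat.div_lt_of_lt_mul (lt_of_lt_of_le i.2 hρ)
    obtain ⟨u, hu, v, hv, huv, h⟩ := hf ⟨_, hi⟩ S hS
    exact ⟨u, hu, v, hv, huv, by simp [h]⟩

/-- Concatenating `m` edge labelings along a code: the vertices are the words of a code of length
`m` any two of which agree in fewer than `k` places, and in each block of `ρ` colors in which two
words differ, one color is omitted. -/
theorem card_le_setColoringRamsey_of_code {V C : Type*} [Fintype V] [DecidableEq V]
    [Fintype C] [DecidableEq C] {n r s ρ m k : ℕ} (hn : 2 ≤ n) (hs : 1 ≤ s) (hsr : s < r)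
    (hmr : m * ρ ≤ r) (hcount : (r - m * ρ) + (k - 1) * ρ + m ≤ r - s)
    (f : Sym2 V → Fin ρ)
    (hf : ∀ (j : Fin ρ) (S : Finset V), S.card = n →
      ∃ u ∈ S, ∃ v ∈ S, u ≠ v ∧ f s(u, v) = j)
    (w : C → Fin m → V)
    (hw : ∀ a b, a ≠ b → (Finset.univ.filter fun x => w a x = w b x).card ≤ k - 1) :
    Fintype.card C ≤ setColoringRamsey n r s := by
  have hρ : 0 < ρ := by
    by_contra h
    have : ρ = 0 := by omega
    subst this
    simp at hcount
    omega
  have hblock : ∀ i : Fin r, i.1 / ρ < m ∨ m * ρ ≤ i.1 := fun i => by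
    rw [← Nat.le_div_iff_mul_le hρ]
    exact lt_or_ge _ _
  refine card_le_setColoringRamsey (V := C)
    (fun e => Finset.univ.filter fun i : Fin r => ∃ h : i.1 / ρ < m,
      ¬ (e.map fun a => w a ⟨i.1 / ρ, h⟩).IsDiag ∧
        i.1 % ρ ≠ (f (e.map fun a => w a ⟨i.1 / ρ, h⟩)).1) (fun e he => ?_)
    (fun i S hS => ?_) (exists_forall_hasMonochromaticClique (by omega) hs hsr)
  · induction e using Sym2.inductionOn with
    | _ a b =>
    simp only [Sym2.map_mk, Sym2.mk_isDiag_iff] at he ⊢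
    set U := Finset.univ.filter fun i : Fin r => ∃ h : i.1 / ρ < m,
      ¬ (w a ⟨i.1 / ρ, h⟩ = w b ⟨i.1 / ρ, h⟩) ∧
        i.1 % ρ ≠ (f s(w a ⟨i.1 / ρ, h⟩, w b ⟨i.1 / ρ, h⟩)).1 with hU
    -- Three sources of omitted colors: those outside the m blocks, whole blocks where the words
    -- agree, and one color per block. These are the three summands of `hcount`.
    have hsub : (Uᶜ).image Fin.val ⊆ Finset.Ico (m * ρ) r ∪
        ((Finset.univ.filter fun x => w a x = w b x) ×ˢ Finset.range ρ).image
          (fun q => ρ * q.1.1 + q.2) ∪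
        Finset.univ.image (fun x : Fin m => ρ * x.1 + (f s(w a x, w b x)).1) := by
      intro y hy
      obtain ⟨i, hi, rfl⟩ := Finset.mem_image.mp hy
      simp only [Finset.mem_union, Finset.mem_Ico, Finset.mem_image, Finset.mem_product,
        Finset.mem_filter, Finset.mem_univ, true_and, Finset.mem_range, Prod.exists]
      rcases hblock i with h | h
      · by_cases hab : w a ⟨i.1 / ρ, h⟩ = w b ⟨i.1 / ρ, h⟩
        · exact Or.inl (Or.inr ⟨⟨i.1 / ρ, h⟩, i.1 % ρ, ⟨hab, Nat.mod_lt _ hρ⟩,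
            Nat.div_add_mod _ _⟩)
        · refine Or.inr ⟨⟨i.1 / ρ, h⟩, ?_⟩
          have : i.1 % ρ = (f s(w a ⟨i.1 / ρ, h⟩, w b ⟨i.1 / ρ, h⟩)).1 := by
            by_contra hne
            exact Finset.mem_compl.mp hi (by
              rw [hU, Finset.mem_filter]
              exact ⟨Finset.mem_univ _, h, hab, hne⟩)
          rw [← this]
          exact Nat.div_add_mod _ _
      · exact Or.inl (Or.inl ⟨h, i.2⟩)
    have hcard := (Finset.card_le_card hsub).trans (Finset.card_union_le _ _)
    have h1 := Finset.card_union_le (Finset.Ico (m * ρ) r)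
      (((Finset.univ.filter fun x => w a x = w b x) ×ˢ Finset.range ρ).image
          (fun q => ρ * q.1.1 + q.2))
    have h2 : (((Finset.univ.filter fun x => w a x = w b x) ×ˢ Finset.range ρ).image
          (fun q => ρ * q.1.1 + q.2)).card ≤ (k - 1) * ρ := by
      refine Finset.card_image_le.trans ?_
      rw [Finset.card_product, Finset.card_range]
      exact Nat.mul_le_mul_right _ (hw a b he)
    have h3 : (Finset.univ.image
        (fun x : Fin m => ρ * x.1 + (f s(w a x, w b x)).1)).card ≤ m :=
      Finset.card_image_le.trans (by simp)
    rw [Finset.card_image_of_injective _ Fin.val_injective, Finset.card_compl,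
      Fintype.card_fin] at hcard
    rw [Nat.card_Ico] at h1
    omega
  · by_contra! hno
    have hmono : ∀ a ∈ S, ∀ b ∈ S, a ≠ b → ∃ h : i.1 / ρ < m,
        w a ⟨i.1 / ρ, h⟩ ≠ w b ⟨i.1 / ρ, h⟩ ∧
        i.1 % ρ ≠ (f s(w a ⟨i.1 / ρ, h⟩, w b ⟨i.1 / ρ, h⟩)).1 := by
      intro a ha b hb hab
      simpa using hno a ha b hb hab
    obtain ⟨a, ha, b, hb, hab⟩ := Finset.one_lt_card.mp (by omega : 1 < S.card)
    obtain ⟨h, -, -⟩ := hmono a ha b hb hab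
    -- Words in a clique of color i differ pairwise in the block of i, so that coordinate carries S
    -- to an n-set of V, which sees the label of i.
    have hinj : Set.InjOn (fun c => w c ⟨i.1 / ρ, h⟩) (S : Set C) := by
      intro a ha b hb heq
      by_contra hab
      obtain ⟨_, h', -⟩ := hmono a ha b hb hab
      exact h' heq
    obtain ⟨u, hu, v, hv, huv, hfe⟩ := hf ⟨i.1 % ρ, Nat.mod_lt _ hρ⟩
      (S.image fun c => w c ⟨i.1 / ρ, h⟩) (by rw [Finset.card_image_of_injOn hinj, hS])
    obtain ⟨a, ha, rfl⟩ := Finset.mem_image.mp hu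
    obtain ⟨b, hb, rfl⟩ := Finset.mem_image.mp hv
    obtain ⟨_, -, h'⟩ := hmono a ha b hb fun hab => huv (hab ▸ rfl)
    exact h' (by rw [hfe])

/-- Evaluations of polynomials of degree less than `k` at `m ≤ p` points (Reed–Solomon code). -/
theorem exists_code_zmod (p : ℕ) [Fact p.Prime] {m : ℕ} (hm : m ≤ p) (k : ℕ) :
    ∃ w : (Fin k → ZMod p) → Fin m → ZMod p, ∀ a b, a ≠ b →
      (Finset.univ.filter fun x => w a x = w b x).card ≤ k - 1 := by
  refine ⟨fun a x => ((Polynomial.degreeLTEquiv (ZMod p) k).symm a).1.eval ((x : ℕ) : ZMod p),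
    fun a b hab => ?_⟩
  by_contra! hlt
  refine hab ((Polynomial.degreeLTEquiv (ZMod p) k).symm.injective (Subtype.ext ?_))
  have hinj : Function.Injective fun x : Fin m => ((x : ℕ) : ZMod p) := by
    intro x y hxy
    have := (ZMod.natCast_eq_natCast_iff' _ _ _).mp hxy
    rw [Nat.mod_eq_of_lt (x.2.trans_le hm), Nat.mod_eq_of_lt (y.2.trans_le hm)] at this
    exact Fin.ext this
  have hk : k ≤ (Finset.univ.filter fun x : Fin m =>
      ((Polynomial.degreeLTEquiv (ZMod p) k).symm a).1.eval ((x : ℕ) : ZMod p) =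
      ((Polynomial.degreeLTEquiv (ZMod p) k).symm b).1.eval ((x : ℕ) : ZMod p)).card := by
    omega
  have hdeg : ∀ q : Polynomial.degreeLT (ZMod p) k, q.1.degree < ((Finset.univ.filter fun x : Fin m =>
      ((Polynomial.degreeLTEquiv (ZMod p) k).symm a).1.eval ((x : ℕ) : ZMod p) =
      ((Polynomial.degreeLTEquiv (ZMod p) k).symm b).1.eval ((x : ℕ) : ZMod p)).card : WithBot ℕ) :=
    fun q => (Polynomial.mem_degreeLT.mp q.2).trans_le (by exact_mod_cast hk)
  exact Polynomial.eq_of_degrees_lt_of_eval_index_eq _ hinj.injOn (hdeg _) (hdeg _)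
    fun x hx => (Finset.mem_filter.mp hx).2

/-! ### Lower bounds for the Ramsey number -/

/-- With ρ = ⌊r/d⌋ + 1 the classes cover the palette and ρd ≤ 2r, so n/(6ρ) ≥ nd/(12r). The factor
1/2 pays for rounding the number of vertices down. -/
theorem half_exp_le_setColoringRamsey {n r s : ℕ} (hs : 1 ≤ s) (hsr : s < r)
    (hnr : 3 * (r + 1) ≤ n) :
    Real.exp (n * (((r : ℝ) - s) / r) / 12) / 2 ≤ (setColoringRamsey n r s : ℝ) := by
  obtain ⟨d, hd⟩ : ∃ d, d = r - s := ⟨_, rfl⟩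
  have hcast : (d : ℝ) = (r : ℝ) - s := by rw [hd]; exact Nat.cast_sub hsr.le
  rw [← hcast]
  have hdpos : 0 < d := by omega
  have hdr : d ≤ r := by omega
  have hd' : (0 : ℝ) < d := by exact_mod_cast hdpos
  have hr' : (0 : ℝ) < r := by exact_mod_cast (by omega : 0 < r)
  set ρ := r / d + 1 with hρ
  have hρle : ρ ≤ r + 1 := by
    have := Nat.div_le_self r d
    omega
  have hρd : (ρ : ℝ) * d ≤ 2 * r := by
    have h1 : r / d * d ≤ r := Nat.div_mul_le_self _ _
    have h2 : ρ * d ≤ 2 * r := by rw [hρ, add_mul]; omega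
    exact_mod_cast h2
  have hρpos : 0 < ρ := Nat.succ_pos _
  have hρ' : (0 : ℝ) < ρ := by exact_mod_cast hρpos
  set x := Real.exp (n / (6 * ρ)) with hx
  have hx1 : 1 ≤ x := Real.one_le_exp (by positivity)
  obtain ⟨f, hf⟩ := exists_labeling_of_card_le_exp (V := Fin ⌊x⌋₊) (n := n) (ρ := ρ) hρpos
    (by omega) (by omega) (by rw [Fintype.card_fin]; exact Nat.floor_le (by linarith))
  have hR := card_le_setColoringRamsey_of_labeling (by omega) hs hsr
    (by rw [← hd]; exact (Nat.lt_mul_div_succ r hdpos).le) f hf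
  rw [Fintype.card_fin] at hR
  have hR' : ((⌊x⌋₊ : ℕ) : ℝ) ≤ setColoringRamsey n r s := by exact_mod_cast hR
  refine le_trans ?_ hR'
  have h1 : (1 : ℝ) ≤ (⌊x⌋₊ : ℕ) := by exact_mod_cast (Nat.one_le_floor_iff x).mpr hx1
  have h2 := Nat.lt_floor_add_one x
  have h3 : Real.exp (n * ((d : ℝ) / r) / 12) ≤ x := by
    refine Real.exp_le_exp.mpr ?_
    rw [le_div_iff₀ (by positivity)]
    have h4 : (n : ℝ) * ((d : ℝ) / r) / 12 * (6 * ρ) = n * (ρ * d / (2 * r)) := by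
      field_simp
      ring
    rw [h4]
    refine mul_le_of_le_one_right (by positivity) ?_
    rw [div_le_one (by positivity)]
    exact hρd
  linarith

/-- The d omitted colors are budgeted as kρ ≤ d/2 for the remainder and the agreeing blocks, and m ≤
d/4 for one color per block. From d² ≤ 20rk and ρd ≤ 5r, the exponent kn/(12ρ) is at least
nd³/(1200r²). -/
theorem exp_le_setColoringRamsey {n r s : ℕ} (hs : 1 ≤ s) (hsr : s < r)
    (hnr : 60 * r * (r + 3) ≤ n) (hd10 : 10 * r ≤ (r - s) ^ 2) :
    Real.exp (n * (((r : ℝ) - s) ^ 3 / (r : ℝ) ^ 2) / 1200) ≤ (setColoringRamsey n r s : ℝ) := by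
  obtain ⟨d, hd⟩ : ∃ d, d = r - s := ⟨_, rfl⟩
  have hcast : (d : ℝ) = (r : ℝ) - s := by rw [hd]; exact Nat.cast_sub hsr.le
  rw [← hcast]
  rw [← hd] at hd10
  have hdpos : 0 < d := by omega
  have hdr : d ≤ r := by omega
  have hrpos : 0 < r := by omega
  have hd' : (0 : ℝ) < d := by exact_mod_cast hdpos
  have hr' : (1 : ℝ) ≤ r := by exact_mod_cast hrpos
  have hn' : (60 * r * (r + 3) : ℝ) ≤ n := by exact_mod_cast hnr
  set ρ := 4 * r / d + 1 with hρ
  have hρd : ρ * d ≤ 5 * r := by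
    have h1 : 4 * r / d * d ≤ 4 * r := Nat.div_mul_le_self _ _
    rw [hρ, add_mul]
    omega
  have hρd4 : 4 * r ≤ ρ * d := by
    rw [mul_comm ρ d]
    exact (Nat.lt_mul_div_succ (4 * r) hdpos).le
  have hρpos : 0 < ρ := Nat.succ_pos _
  have hρ5 : ρ ≤ 5 * r := (Nat.le_mul_of_pos_right _ hdpos).trans hρd
  have hρ' : (0 : ℝ) < ρ := by exact_mod_cast hρpos
  have hρ5' : (ρ : ℝ) ≤ 5 * r := by exact_mod_cast hρ5
  have hρd' : (ρ : ℝ) * d ≤ 5 * r := by exact_mod_cast hρd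
  set m := r / ρ with hm
  have hmρ : m * ρ ≤ r := Nat.div_mul_le_self _ _
  have h4m : 4 * m ≤ d := by
    refine Nat.le_of_mul_le_mul_left (?_ : r * (4 * m) ≤ r * d) hrpos
    calc r * (4 * m) = m * (4 * r) := by ring
      _ ≤ m * (ρ * d) := Nat.mul_le_mul_left _ hρd4
      _ = m * ρ * d := by ring
      _ ≤ r * d := Nat.mul_le_mul_right _ hmρ
  set k := d ^ 2 / (10 * r) with hk
  have hk1 : 1 ≤ k := (Nat.one_le_div_iff (by omega)).mpr hd10
  have h2k : 2 * (k * ρ) ≤ d := by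
    have h1 : k * (10 * r) ≤ d ^ 2 := Nat.div_mul_le_self _ _
    refine Nat.le_of_mul_le_mul_left (?_ : 5 * r * d * (2 * (k * ρ)) ≤ 5 * r * d * d) (by positivity)
    calc 5 * r * d * (2 * (k * ρ)) = (k * (10 * r)) * (ρ * d) := by ring
      _ ≤ d ^ 2 * (5 * r) := Nat.mul_le_mul h1 hρd
      _ = _ := by ring
  have hcount : (r - m * ρ) + (k - 1) * ρ + m ≤ r - s := by
    have h1 : r < ρ * (m + 1) := Nat.lt_mul_div_succ r hρpos
    have h2 : r - m * ρ ≤ ρ := by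
      rw [mul_add, mul_comm ρ m] at h1
      omega
    have h3 : (k - 1) * ρ + ρ = k * ρ := by
      rw [← Nat.succ_mul, Nat.succ_eq_add_one, Nat.sub_add_cancel hk1]
    omega
  set x := Real.exp (n / (12 * ρ)) with hx
  have hxr : (r : ℝ) + 3 ≤ x := by
    have h1 : (r : ℝ) + 3 ≤ n / (12 * ρ) := by
      rw [le_div_iff₀ (by positivity)]
      nlinarith
    linarith [Real.add_one_le_exp ((n : ℝ) / (12 * ρ))]
  -- Bertrand's postulate gives a prime alphabet with x < p ≤ x²: at least r ≥ m evaluation points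
  -- are available, and the labeling on e^(n/(6ρ)) = x² vertices still applies.
  obtain ⟨p, hp, hpx, hp2⟩ := Nat.exists_prime_lt_and_le_two_mul ⌈x⌉₊
    (Nat.ceil_pos.mpr (by linarith)).ne'
  have hxp : x ≤ p := (Nat.le_ceil x).trans (by exact_mod_cast hpx.le)
  have hpx2 : (p : ℝ) ≤ Real.exp (n / (6 * ρ)) := by
    have h1 : Real.exp (n / (6 * ρ)) = x * x := by
      rw [hx, ← Real.exp_add]
      congr 1
      field_simp
      ring
    have h2 : (p : ℝ) ≤ 2 * (⌈x⌉₊ : ℕ) := by exact_mod_cast hp2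
    have h3 := Nat.ceil_lt_add_one (show 0 ≤ x by linarith)
    nlinarith
  have : Fact p.Prime := ⟨hp⟩
  have hrp : r ≤ p := by
    have : (r : ℝ) ≤ p := by linarith
    exact_mod_cast this
  have hnbig : 60 * r * 3 ≤ n := (Nat.mul_le_mul_left _ (by omega)).trans hnr
  obtain ⟨f, hf⟩ := exists_labeling_of_card_le_exp (V := ZMod p) (n := n) (ρ := ρ) hρpos
    (by omega) (by omega) (by rwa [ZMod.card])
  obtain ⟨w, hw⟩ := exists_code_zmod p (m := m) (by omega) k
  have hR := card_le_setColoringRamsey_of_code (by omega) hs hsr hmρ hcount f hf w hw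
  rw [Fintype.card_fun, ZMod.card, Fintype.card_fin] at hR
  have hR' : (p : ℝ) ^ k ≤ setColoringRamsey n r s := by exact_mod_cast hR
  refine le_trans ?_ hR'
  calc Real.exp (n * ((d : ℝ) ^ 3 / (r : ℝ) ^ 2) / 1200) ≤ Real.exp (k * (n / (12 * ρ))) := by
        refine Real.exp_le_exp.mpr ?_
        have h1 : (d : ℝ) ^ 2 ≤ 20 * r * k := by
          have h2 : d ^ 2 < 10 * r * (k + 1) := Nat.lt_mul_div_succ _ (by omega)
          have h3 : d ^ 2 ≤ 20 * r * k := by nlinarith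
          exact_mod_cast h3
        rw [mul_div_assoc', mul_div_assoc', div_div, div_le_div_iff₀ (by positivity) (by positivity)]
        calc (n : ℝ) * (d : ℝ) ^ 3 * (12 * (ρ : ℝ)) = 12 * n * ((d : ℝ) ^ 2 * (ρ * d)) := by ring
          _ ≤ 12 * n * (20 * (r : ℝ) * k * (5 * r)) := by gcongr
          _ = _ := by ring
    _ = x ^ k := Real.exp_nat_mul _ _
    _ ≤ (p : ℝ) ^ k := by gcongr

/-- If d² ≥ 10r the cubic term is the maximum and the code bound applies. Otherwise it is at most
10d/r, and the simple bound wins by its better constant. -/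
theorem half_exp_max_le_setColoringRamsey {n r s : ℕ} (hs : 1 ≤ s) (hsr : s < r)
    (hnr : 60 * r * (r + 3) ≤ n) :
    Real.exp (1 / 1200 * (n : ℝ) *
      max (((r : ℝ) - s) / r) (((r : ℝ) - s) ^ 3 / (r : ℝ) ^ 2)) / 2 ≤
      (setColoringRamsey n r s : ℝ) := by
  have hcast : ((r - s : ℕ) : ℝ) = (r : ℝ) - s := Nat.cast_sub hsr.le
  have hd' : (0 : ℝ) < (r : ℝ) - s := by rw [sub_pos]; exact_mod_cast hsr
  have hr' : (0 : ℝ) < r := by exact_mod_cast (by omega : 0 < r)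
  have hcube : ((r : ℝ) - s) ^ 3 / (r : ℝ) ^ 2 = ((r : ℝ) - s) ^ 2 / r * (((r : ℝ) - s) / r) := by
    field_simp
  have hdr : 0 < ((r : ℝ) - s) / r := by positivity
  rcases le_or_gt (10 * r) ((r - s) ^ 2) with h | h
  · have h1 : 1 ≤ ((r : ℝ) - s) ^ 2 / r := by
      rw [le_div_iff₀ hr', ← hcast]
      have : (10 * r : ℝ) ≤ ((r - s : ℕ) : ℝ) ^ 2 := by exact_mod_cast h
      linarith
    rw [max_eq_right (by rw [hcube]; exact le_mul_of_one_le_left hdr.le h1)]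
    have h2 := exp_le_setColoringRamsey hs hsr hnr h
    have h3 : 1 / 1200 * (n : ℝ) * (((r : ℝ) - s) ^ 3 / (r : ℝ) ^ 2) =
        n * (((r : ℝ) - s) ^ 3 / (r : ℝ) ^ 2) / 1200 := by ring
    rw [h3]
    linarith [Real.exp_pos (n * (((r : ℝ) - s) ^ 3 / (r : ℝ) ^ 2) / 1200)]
  · have h1 : ((r : ℝ) - s) ^ 2 / r ≤ 10 := by
      rw [div_le_iff₀ hr', ← hcast]
      exact_mod_cast h.le
    have hmax : max (((r : ℝ) - s) / r) (((r : ℝ) - s) ^ 3 / (r : ℝ) ^ 2) ≤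
        10 * (((r : ℝ) - s) / r) := by
      refine max_le (by linarith) ?_
      rw [hcube]
      exact mul_le_mul_of_nonneg_right h1 hdr.le
    refine le_trans ?_ (half_exp_le_setColoringRamsey hs hsr (by nlinarith))
    refine div_le_div_of_nonneg_right (Real.exp_le_exp.mpr ?_) zero_le_two
    have h2 := mul_le_mul_of_nonneg_left hmax (show (0 : ℝ) ≤ 1 / 1200 * n by positivity)
    have h3 : (0 : ℝ) ≤ n * (((r : ℝ) - s) / r) := by positivity
    linarith

/-! ### Passage to base 2 and the final constants -/

theorem two_rpow_le_exp {x : ℝ} (hx : 0 ≤ x) : (2 : ℝ) ^ x ≤ Real.exp x := by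
  rw [← Real.exp_one_rpow x]
  exact Real.rpow_le_rpow zero_le_two (by linarith [Real.exp_one_gt_d9]) hx

theorem exp_le_two_rpow_two_mul {x : ℝ} (hx : 0 ≤ x) : Real.exp x ≤ (2 : ℝ) ^ (2 * x) := by
  rw [Real.rpow_mul zero_le_two, ← Real.exp_one_rpow x]
  refine Real.rpow_le_rpow (Real.exp_pos _).le ?_ hx
  norm_num
  linarith [Real.exp_one_lt_d9]

theorem one_le_setColoringRamsey {n r s : ℕ} (hn : 1 ≤ n) (hs : 1 ≤ s) (hsr : s < r) :
    1 ≤ setColoringRamsey n r s :=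
  (Nat.sInf_mem (exists_forall_hasMonochromaticClique hn hs hsr)).1

theorem max_div_le {r s : ℕ} (hs : 1 ≤ s) (hsr : s < r) :
    max (((r : ℝ) - s) / r) (((r : ℝ) - s) ^ 3 / (r : ℝ) ^ 2) ≤ r := by
  have hs' : (1 : ℝ) ≤ s := by exact_mod_cast hs
  have hsr' : (s : ℝ) < r := by exact_mod_cast hsr
  have hr' : (0 : ℝ) < r := by linarith
  refine max_le ?_ ?_
  · rw [div_le_iff₀ hr']
    nlinarith
  · rw [div_le_iff₀ (by positivity), ← pow_succ']
    exact pow_le_pow_left₀ (by linarith) (by linarith) 3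

theorem two_rpow_mul_le_setColoringRamsey {n r s : ℕ} (hn : 1 ≤ n) (hs : 1 ≤ s) (hsr : s < r) :
    (2 : ℝ) ^ (-(60 * (r : ℝ) * (r + 3) * r) - 1) * (2 : ℝ) ^ (1 / 1200 * (n : ℝ) *
      max (((r : ℝ) - s) / r) (((r : ℝ) - s) ^ 3 / (r : ℝ) ^ 2)) ≤ setColoringRamsey n r s := by
  set X := max (((r : ℝ) - s) / r) (((r : ℝ) - s) ^ 3 / (r : ℝ) ^ 2) with hX
  have hXr : X ≤ r := max_div_le hs hsr
  have hX0 : 0 ≤ X := le_max_of_le_left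
    (div_nonneg (by rw [sub_nonneg]; exact_mod_cast hsr.le) (Nat.cast_nonneg r))
  have hr0 : (0 : ℝ) ≤ 60 * (r : ℝ) * (r + 3) * r := by positivity
  rcases le_or_gt (60 * r * (r + 3)) n with h | h
  · refine le_trans ?_ (half_exp_max_le_setColoringRamsey hs hsr h)
    have h1 := two_rpow_le_exp (show 0 ≤ 1 / 1200 * (n : ℝ) * X by positivity)
    have h2 : (2 : ℝ) ^ (-(60 * (r : ℝ) * (r + 3) * r) - 1) ≤ 1 / 2 := by
      rw [show (1 / 2 : ℝ) = (2 : ℝ) ^ (-1 : ℝ) by rw [Real.rpow_neg_one]; norm_num]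
      exact Real.rpow_le_rpow_of_exponent_le one_le_two (by linarith)
    calc _ ≤ 1 / 2 * Real.exp (1 / 1200 * (n : ℝ) * X) := by gcongr
      _ = _ := by ring
  -- For small n the exponent is at most nr ≤ 60r²(r + 3), so the prefactor pushes the left side
  -- below 1.
  · have h1 : (1 : ℝ) ≤ setColoringRamsey n r s := by
      exact_mod_cast one_le_setColoringRamsey hn hs hsr
    refine le_trans ?_ h1
    rw [← Real.rpow_add two_pos]
    refine Real.rpow_le_one_of_one_le_of_nonpos one_le_two ?_
    have h2 : (n : ℝ) ≤ 60 * r * (r + 3) := by exact_mod_cast h.le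
    have h3 : (n : ℝ) * X ≤ 60 * r * (r + 3) * r := by gcongr
    have h4 : 0 ≤ (n : ℝ) * X := by positivity
    linarith

theorem setColoringRamsey_le_two_rpow {n r s : ℕ} (hn : 1 ≤ n) (hs : 1 ≤ s) (hsr : s < r)
    (hnr : (r : ℝ) ≤ n * ((r : ℝ) - s) ^ 2) :
    (setColoringRamsey n r s : ℝ) ≤ (2 : ℝ) ^ (800 * (n : ℝ) * (((r : ℝ) - s) ^ 2 / r) *
      Real.log ((r : ℝ) / min (s : ℝ) ((r : ℝ) - s))) := by
  have hlog := Real.log_nonneg (one_le_two.trans (two_le_div_min hs hsr))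
  refine (setColoringRamsey_le_exp hn hs hsr hnr).trans
    ((exp_le_two_rpow_two_mul (by positivity)).trans_eq ?_)
  congr 1
  ring

theorem setColoringRamsey_le_mul_two_rpow {n r s : ℕ} (hn : 1 ≤ n) (hs : 1 ≤ s) (hsr : s < r) :
    (setColoringRamsey n r s : ℝ) ≤ ((1 + (r : ℝ)) ^ (r * r) + 1) *
      (2 : ℝ) ^ (800 * (n : ℝ) * (((r : ℝ) - s) ^ 2 / r) *
        Real.log ((r : ℝ) / min (s : ℝ) ((r : ℝ) - s))) := by
  have hlog := Real.log_nonneg (one_le_two.trans (two_le_div_min hs hsr))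
  have hpos : (0 : ℝ) ≤ (1 + (r : ℝ)) ^ (r * r) := by positivity
  rcases le_or_gt (r : ℝ) (n * ((r : ℝ) - s) ^ 2) with h | h
  · exact (setColoringRamsey_le_two_rpow hn hs hsr h).trans
      (le_mul_of_one_le_left (by positivity) (by linarith))
  -- If n(r - s)² < r then n ≤ r, and the chasing bound is controlled by r alone.
  · have h1 : (1 : ℝ) ≤ (r : ℝ) - s := by
      rw [← Nat.cast_sub hsr.le]
      exact_mod_cast (by omega : 1 ≤ r - s)
    have hnr : n ≤ r := by
      have : (n : ℝ) * 1 ≤ n * ((r : ℝ) - s) ^ 2 := by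
        gcongr
        nlinarith
      have : (n : ℝ) ≤ r := by linarith
      exact_mod_cast this
    have hs' : (1 : ℝ) ≤ s := by exact_mod_cast hs
    calc (setColoringRamsey n r s : ℝ) ≤ (1 + (r : ℝ) / s) ^ (r * n) + 1 :=
          setColoringRamsey_le_pow hn hs hsr
      _ ≤ (1 + (r : ℝ)) ^ (r * n) + 1 := by
          gcongr
          exact div_le_self (Nat.cast_nonneg r) hs'
      _ ≤ (1 + (r : ℝ)) ^ (r * r) + 1 := by
          gcongr
          linarith [Nat.cast_nonneg (α := ℝ) r]
      _ ≤ _ := le_mul_of_one_le_right (by linarith)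
          (Real.one_le_rpow one_le_two (by positivity))

theorem two_rpow_le_setColoringRamsey {ε : ℝ} (hε : 0 < ε) {n r s : ℕ} (hs : 1 ≤ s)
    (hsr : (s : ℝ) < (1 - ε) * r) (hlt : s < r) (hnr : 60 * r * (r + 3) ≤ n)
    (hnε : 2400 / ε ^ 3 ≤ n) :
    (2 : ℝ) ^ (ε ^ 3 / 2400 * (n : ℝ) * r) ≤ setColoringRamsey n r s := by
  refine le_trans ?_ (half_exp_max_le_setColoringRamsey hs hlt hnr)
  have hr1 : (1 : ℝ) ≤ r := by exact_mod_cast (by omega : 1 ≤ r)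
  have hX : ε ^ 3 * r ≤ max (((r : ℝ) - s) / r) (((r : ℝ) - s) ^ 3 / (r : ℝ) ^ 2) := by
    refine le_max_of_le_right ?_
    rw [le_div_iff₀ (by positivity)]
    calc ε ^ 3 * r * (r : ℝ) ^ 2 = (ε * r) ^ 3 := by ring
      _ ≤ ((r : ℝ) - s) ^ 3 := pow_le_pow_left₀ (by positivity) (by linarith) 3
  -- The bound `hnε` on n makes the exponent at least 1, so doubling it absorbs the factor 1/2.
  have hone : 1 ≤ ε ^ 3 / 2400 * (n : ℝ) * r := by
    rw [div_le_iff₀ (by positivity)] at hnε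
    have : 1 ≤ ε ^ 3 / 2400 * (n : ℝ) := by linarith
    nlinarith
  set z := ε ^ 3 / 2400 * (n : ℝ) * r with hz
  rw [le_div_iff₀ two_pos]
  calc (2 : ℝ) ^ z * 2 = (2 : ℝ) ^ (z + 1) := by rw [Real.rpow_add two_pos, Real.rpow_one]
    _ ≤ (2 : ℝ) ^ (2 * z) := Real.rpow_le_rpow_of_exponent_le one_le_two (by linarith)
    _ ≤ Real.exp (2 * z) := two_rpow_le_exp (by linarith)
    _ ≤ _ := by
      refine Real.exp_le_exp.mpr ?_
      have := mul_le_mul_of_nonneg_left hX (show (0 : ℝ) ≤ 1 / 1200 * n by positivity)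
      rw [hz]
      linarith

theorem setColoringRamsey_le_two_rpow_logb {ε : ℝ} (hε : 0 < ε) {n r s : ℕ} (hn : 1 ≤ n)
    (hs : 1 ≤ s) (hsr : s < r) (hεs : ε * r < s) :
    (setColoringRamsey n r s : ℝ) ≤ (2 : ℝ) ^ (Real.logb 2 (2 * (1 + 1 / ε)) * (n : ℝ) * r) := by
  have hs' : (1 : ℝ) ≤ s := by exact_mod_cast hs
  have hrn : 1 ≤ r * n := Nat.mul_pos (by omega) (by omega)
  have h1 : (r : ℝ) / s ≤ 1 / ε := by
    rw [div_le_div_iff₀ (by linarith) hε]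
    linarith
  calc (setColoringRamsey n r s : ℝ) ≤ (1 + (r : ℝ) / s) ^ (r * n) + 1 :=
        setColoringRamsey_le_pow hn hs hsr
    _ ≤ (1 + 1 / ε) ^ (r * n) + (1 + 1 / ε) ^ (r * n) := by
        have h2 : (1 : ℝ) ≤ (1 + 1 / ε) ^ (r * n) :=
          one_le_pow₀ (by linarith [show 0 < 1 / ε by positivity])
        gcongr
    _ = 2 * (1 + 1 / ε) ^ (r * n) := by ring
    _ ≤ 2 ^ (r * n) * (1 + 1 / ε) ^ (r * n) := by
        gcongr
        exact le_self_pow₀ one_le_two (by omega)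
    _ = (2 * (1 + 1 / ε)) ^ (r * n) := (mul_pow _ _ _).symm
    _ = _ := by
        rw [mul_assoc, Real.rpow_mul zero_le_two,
          Real.rpow_logb two_pos (by norm_num) (by positivity), ← Real.rpow_natCast]
        congr 1
        push_cast
        ring

theorem theorem1 :
    (∃ c : ℝ, 0 < c ∧ ∃ c' : ℝ, 0 < c' ∧ ∃ a b : ℕ → ℝ, (∀ r, 0 < a r) ∧ (∀ r, 0 < b r) ∧
      ∀ n r s : ℕ, 3 ≤ n → 1 ≤ s → s < r →
        -- lower bound
        a r * (2 : ℝ) ^ (c * (n : ℝ) * max (((r : ℝ) - s) / r) (((r : ℝ) - s) ^ 3 / (r : ℝ) ^ 2))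
            ≤ (setColoringRamsey n r s : ℝ) ∧
        -- upper bound
        ((r : ℝ) ≤ (n : ℝ) * ((r : ℝ) - s) ^ 2 →
          (setColoringRamsey n r s : ℝ) ≤
            (2 : ℝ) ^ (c' * (n : ℝ) * (((r : ℝ) - s) ^ 2 / r) *
              Real.log ((r : ℝ) / min (s : ℝ) ((r : ℝ) - s)))) ∧
        -- upper bound for all parameters, up to a factor that depends only on `r`
        (setColoringRamsey n r s : ℝ) ≤
            b r * (2 : ℝ) ^ (c' * (n : ℝ) * (((r : ℝ) - s) ^ 2 / r) *
              Real.log ((r : ℝ) / min (s : ℝ) ((r : ℝ) - s)))) ∧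
    -- the exponent is of order `n * r` if `s / r` is bounded away from `0` and `1`
    (∀ ε : ℝ, 0 < ε → ∃ c₁ : ℝ, 0 < c₁ ∧ ∃ c₂ : ℝ, 0 < c₂ ∧ ∃ n₀ : ℕ → ℕ,
      ∀ n r s : ℕ, 3 ≤ n → ε * r < s → (s : ℝ) < (1 - ε) * r →
        (n₀ r ≤ n → (2 : ℝ) ^ (c₁ * (n : ℝ) * r) ≤ (setColoringRamsey n r s : ℝ)) ∧
        (setColoringRamsey n r s : ℝ) ≤ (2 : ℝ) ^ (c₂ * (n : ℝ) * r)) := by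
  refine ⟨⟨1 / 1200, by norm_num, 800, by norm_num,
    fun r => (2 : ℝ) ^ (-(60 * (r : ℝ) * (r + 3) * r) - 1), fun r => (1 + (r : ℝ)) ^ (r * r) + 1,
    fun r => by positivity, fun r => by positivity, fun n r s hn hs hsr =>
      ⟨two_rpow_mul_le_setColoringRamsey (by omega) hs hsr,
        setColoringRamsey_le_two_rpow (by omega) hs hsr,
        setColoringRamsey_le_mul_two_rpow (by omega) hs hsr⟩⟩, fun ε hε => ?_⟩
  refine ⟨ε ^ 3 / 2400, by positivity, Real.logb 2 (2 * (1 + 1 / ε)),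
    Real.logb_pos one_lt_two (by linarith [show 0 < 1 / ε by positivity]),
    fun r => max (60 * r * (r + 3)) ⌈2400 / ε ^ 3⌉₊, fun n r s hn hεs hsε => ?_⟩
  have hr0 : (0 : ℝ) ≤ ε * r := by positivity
  have hs : 1 ≤ s := by
    have : (0 : ℝ) < s := by linarith
    exact_mod_cast this
  have hsr : s < r := by
    have : (s : ℝ) < r := by linarith
    exact_mod_cast this
  refine ⟨fun hn₀ => two_rpow_le_setColoringRamsey hε hs hsε hsr ((le_max_left _ _).trans hn₀) ?_,
    setColoringRamsey_le_two_rpow_logb hε (by omega) hs hsr hεs⟩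
  exact (Nat.le_ceil _).trans (by exact_mod_cast (le_max_right _ _).trans hn₀)
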